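/- Let $k$ be an algebraically closed field of characteristic zero, $G$ a finite group, and $\alpha:G\times G\times G\to k^*$ a normalised 3-cocycle: $\alpha(g,h,l)\alpha(f,gh,l)\alpha(f,g,h)=\alpha(fg,h,l)\alpha(f,g,hl)$, and $\alpha(f,g,h)=1$ whenever one of $f,g,h$ is the identity $e$. Put $$\alpha(f,g|h)=\alpha(f,g,h)^{-1}\alpha(f,ghg^{-1},g)\,\alpha(fgh(fg)^{-1},f,g)^{-1},$$ $$\alpha(f|g,h)=\alpha(f,g,h)\,\alpha(fgf^{-1},f,h)^{-1}\alpha(fgf^{-1},fhf^{-1},f).$$ Let $\mathcal Z(G,\alpha)$ be the braided monoidal category of finite-dimensional $G$-graded vector spaces $V=\bigoplus_{g\in G}V_g$ with automorphisms $v\mapsto f.v$ ($f\in G$) such that $f.V_g=V_{fgf^{-1}}$ and $(fg).v=\alpha(f,g|h)\,f.(g.v)$ for $v\in V_h$; morphisms are the linear maps that preserve grading and action. The action on the graded tensor product is $f.(x\otimes y)=\alpha(f|g,h)\,f.x\otimes f.y$, the associator is $x\otimes(y\otimes z)\mapsto\alpha(f,g,h)(x\otimes y)\otimes z$ for homogeneous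 elements of the degrees $f,g,h$, the unit is $k$ in degree $e$ with trivial action, and the braiding is $x\otimes y\mapsto f.y\otimes x$ for $x$ of degree $f$. So an algebra in $\mathcal Z(G,\alpha)$ is an object $A$ with a graded bilinear multiplication such that $f.(ab)=\alpha(f|g,h)(f.a)(f.b)$ for $a\in A_g$, $b\in A_h$ and $a(bc)=\alpha(f,g,h)(ab)c$ for $a\in A_f,b\in A_g,c\in A_h$, and a $G$-invariant two-sided unit in $A_e$. It is commutative if $ab=(f.b)a$ for $a\in A_f$, $b\in A$; it is separable if the pairing $(a,b)\mapsto\tau(ab)$ is nondegenerate, where $\tau(a)$ is the trace of the left multiplication by $a$; it is indecomposable if it is nonzero and not a direct sum of two nonzero algebras in $\mathcal Z(G,\alpha)$. An algebra is called étale if it is indecomposable, commutative and separable. For a subgroup $H\subseteq G$ and an algebra $B$ in $\mathcal Z(H,\alpha|_H)$, regarded as a $G$-graded space supported in $H$, let $E(B)=\bigoplus_{f\in G}E(B)_f$, where $E(B)_f$ is the space of the maps $a:G\to B$ such that, for all $x\in G$ and $h\in H$, $$a(x)\in B_{x^{-1}fx},\qquad a(xh)=\alpha(h^{-1},x^{-1}|f)\,h^{-1}.a(x).$$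 It is an algebra in $\mathcal Z(G,\alpha)$, with $(g.a)(x)=\alpha(x^{-1},g|f)^{-1}a(g^{-1}x)$ and $(ab)(x)=\alpha(x^{-1}|f,f')\,a(x)b(x)$ for $a\in E(B)_f$, $b\in E(B)_{f'}$, the unit being the constant map with value $1_B$. **Theorem.** Every étale algebra in $\mathcal Z(G,\alpha)$ is isomorphic, as an algebra in $\mathcal Z(G,\alpha)$, to $$A(H,F,\gamma,\varepsilon)=E\big(k[F,\gamma,\varepsilon]\big)$$ for some subgroup $H\subseteq G$, normal subgroup $F\trianglelefteq H$, normalised cochain $\gamma:F\times F\to k^*$ (that is, $\gamma(e,f)=\gamma(f,e)=1$) with $d\gamma=\alpha|_F$, i.e. $\gamma(g,h)\gamma(fg,h)^{-1}\gamma(f,gh)\gamma(f,g)^{-1}=\alpha(f,g,h)$ for $f,g,h\in F$, and map $\varepsilon:H\times F\to k^*$, $(h,f)\mapsto\varepsilon_h(f)$, satisfying $$\varepsilon_{gh}(f)=\varepsilon_g(hfh^{-1})\,\varepsilon_h(f)\,\alpha(g,h|f),\qquad g,h\in H,\ f\in F,$$ $$\gamma(f,g)\,\varepsilon_h(fg)=\alpha(h|f,g)\,\varepsilon_h(f)\,\varepsilon_h(g)\,\gamma(hfh^{-1},hgh^{-1}),\qquad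 h\in H,\ f,g\in F,$$ $$\gamma(f,g)=\varepsilon_f(g)\,\gamma(fgf^{-1},f),\qquad f,g\in F.$$ Here $k[F,\gamma,\varepsilon]$ is the algebra in $\mathcal Z(H,\alpha|_H)$ with basis $(e_f)_{f\in F}$, $e_f$ of degree $f$, multiplication $e_fe_g=\gamma(f,g)e_{fg}$ and $H$-action $h.e_f=\varepsilon_h(f)e_{hfh^{-1}}$. -/

import Mathlib

universe u v w w'

namespace TwistedCentre

set_option linter.unusedSimpArgs false
set_option linter.unusedSectionVars false

/-- A normalised 3-cocycle of `G` with coefficients in `kˣ` (trivial action). -/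
structure Cocycle3 (G : Type v) [Group G] (k : Type u) [Field k] where
  toFun : G → G → G → kˣ
  cocycle : ∀ f g h l, toFun g h l * toFun f (g * h) l * toFun f g h =
    toFun (f * g) h l * toFun f g (h * l)
  one_left : ∀ g h, toFun 1 g h = 1
  one_mid : ∀ f h, toFun f 1 h = 1
  one_right : ∀ f g, toFun f g 1 = 1

namespace Cocycle3

variable {G : Type v} [Group G] {k : Type u} [Field k]

instance : CoeFun (Cocycle3 G k) (fun _ => G → G → G → kˣ) := ⟨Cocycle3.toFun⟩

/-- `α(f, g | h) = α(f,g,h)⁻¹ α(f, ghg⁻¹, g) α(fgh(fg)⁻¹, f, g)⁻¹`. -/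
def proj (α : Cocycle3 G k) (f g h : G) : kˣ :=
  (α f g h)⁻¹ * α f (g * h * g⁻¹) g * (α (f * g * h * (f * g)⁻¹) f g)⁻¹

/-- `α(f | g, h) = α(f,g,h) α(fgf⁻¹, f, h)⁻¹ α(fgf⁻¹, fhf⁻¹, f)`. -/
def tens (α : Cocycle3 G k) (f g h : G) : kˣ :=
  α f g h * (α (f * g * f⁻¹) f h)⁻¹ * α (f * g * f⁻¹) (f * h * f⁻¹) f

/-- The restriction of a cocycle to a subgroup. -/
def restrict (α : Cocycle3 G k) (H : Subgroup G) : Cocycle3 H k where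
  toFun f g h := α f g h
  cocycle f g h l := α.cocycle f g h l
  one_left g h := α.one_left g h
  one_mid f h := α.one_mid f h
  one_right f g := α.one_right f g

lemma proj_restrict (α : Cocycle3 G k) (H : Subgroup G) (f g h : H) :
    (α.restrict H).proj f g h = α.proj f g h := rfl

lemma tens_restrict (α : Cocycle3 G k) (H : Subgroup G) (f g h : H) :
    (α.restrict H).tens f g h = α.tens f g h := rfl

lemma proj_proj (α : Cocycle3 G k) (f g h u : G) :
    α.proj f (g * h) u * α.proj g h u = α.proj (f * g) h u * α.proj f g (h * u * h⁻¹) := by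
  have h1 := congrArg Additive.ofMul (α.cocycle f g h u)
  have h2 := congrArg Additive.ofMul (α.cocycle f g (h * u * h⁻¹) h)
  have h3 := congrArg Additive.ofMul (α.cocycle f (g * h * u * (g * h)⁻¹) g h)
  have h4 := congrArg Additive.ofMul (α.cocycle (f * g * h * u * (f * g * h)⁻¹) f g h)
  apply Additive.ofMul.injective
  simp only [proj, ofMul_mul, ofMul_inv, mul_assoc, mul_inv_rev, inv_mul_cancel_left,
    mul_inv_cancel_left, inv_mul_cancel, mul_inv_cancel, mul_one] at *
  linear_combination (norm := abel) - h1 + h2 - h3 + h4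

lemma tens_proj (α : Cocycle3 G k) (f g u v : G) :
    α.tens (f * g) u v * α.proj f g u * α.proj f g v =
      α.proj f g (u * v) * α.tens g u v * α.tens f (g * u * g⁻¹) (g * v * g⁻¹) := by
  have h1 := congrArg Additive.ofMul (α.cocycle f g u v)
  have h2 := congrArg Additive.ofMul (α.cocycle f (g * u * g⁻¹) g v)
  have h3 := congrArg Additive.ofMul (α.cocycle (f * g * u * (f * g)⁻¹) f g v)
  have h4 := congrArg Additive.ofMul (α.cocycle f (g * u * g⁻¹) (g * v * g⁻¹) g)
  have h5 := congrArg Additive.ofMul (α.cocycle (f * g * u * (f * g)⁻¹) f (g * v * g⁻¹) g)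
  have h6 := congrArg Additive.ofMul
    (α.cocycle (f * g * u * (f * g)⁻¹) (f * g * v * (f * g)⁻¹) f g)
  apply Additive.ofMul.injective
  simp only [proj, tens, ofMul_mul, ofMul_inv, mul_assoc, mul_inv_rev, inv_mul_cancel_left,
    mul_inv_cancel_left, inv_mul_cancel, mul_inv_cancel, mul_one] at *
  linear_combination (norm := abel) - h1 + h2 - h3 - h4 + h5 - h6

lemma tens_tens (α : Cocycle3 G k) (f g h u : G) :
    α g h u * α.tens f (g * h) u * α.tens f g h =
      α.tens f g (h * u) * α.tens f h u * α (f * g * f⁻¹) (f * h * f⁻¹) (f * u * f⁻¹) := by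
  have h1 := congrArg Additive.ofMul (α.cocycle f g h u)
  have h2 := congrArg Additive.ofMul (α.cocycle (f * g * f⁻¹) f h u)
  have h3 := congrArg Additive.ofMul (α.cocycle (f * g * f⁻¹) (f * h * f⁻¹) f u)
  have h4 := congrArg Additive.ofMul
    (α.cocycle (f * g * f⁻¹) (f * h * f⁻¹) (f * u * f⁻¹) f)
  apply Additive.ofMul.injective
  simp only [tens, ofMul_mul, ofMul_inv, mul_assoc, mul_inv_rev, inv_mul_cancel_left,
    mul_inv_cancel_left, inv_mul_cancel, mul_inv_cancel, mul_one] at *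
  linear_combination (norm := abel) h1 - h2 + h3 - h4

end Cocycle3

/-- An object of `Z(G, α)`: a finite-dimensional `G`-graded vector space with an `α`-projective
`G`-action. -/
structure ZObj {G : Type v} [Group G] {k : Type u} [Field k] (α : Cocycle3 G k) where
  carrier : Type w
  [addCommGroup : AddCommGroup carrier]
  [module : Module k carrier]
  [finiteDimensional : FiniteDimensional k carrier]
  /-- the homogeneous components -/
  grade : G → Submodule k carrier
  indep : iSupIndep grade
  iSup_grade : ⨆ g, grade g = ⊤
  /-- the action of the elements of `G` -/
  act : G → carrier →ₗ[k] carrier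
  act_bijective : ∀ f, Function.Bijective (act f)
  map_act : ∀ f g, (grade g).map (act f) = grade (f * g * f⁻¹)
  act_act : ∀ f g h, ∀ x ∈ grade h, act (f * g) x = (α.proj f g h : k) • act f (act g x)

attribute [instance] ZObj.addCommGroup ZObj.module ZObj.finiteDimensional

/-- An algebra in `Z(G, α)`: an object `A` with morphisms `A ⊗ A → A` and `I → A` of `Z(G, α)`,
associative with respect to the associator of `Z(G, α)`, and unital. A morphism `A ⊗ A → A` is
written as a bilinear map that respects the degrees and the action
`f.(x ⊗ y) = α(f | g, h) f.x ⊗ f.y` (`x` of degree `g`, `y` of degree `h`) of `G` on `A ⊗ A`; the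
associator is `x ⊗ (y ⊗ z) ↦ α(f, g, h) (x ⊗ y) ⊗ z` on elements of degrees `f`, `g`, `h`. -/
structure ZAlg {G : Type v} [Group G] {k : Type u} [Field k] (α : Cocycle3 G k) extends
    ZObj.{u, v, w} α where
  mul : carrier →ₗ[k] carrier →ₗ[k] carrier
  one : carrier
  mul_mem : ∀ f g, ∀ x ∈ grade f, ∀ y ∈ grade g, mul x y ∈ grade (f * g)
  act_mul : ∀ f g h, ∀ x ∈ grade g, ∀ y ∈ grade h,
    act f (mul x y) = (α.tens f g h : k) • mul (act f x) (act f y)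
  one_mem : one ∈ grade 1
  act_one : ∀ f, act f one = one
  mul_assoc : ∀ f g h, ∀ x ∈ grade f, ∀ y ∈ grade g, ∀ z ∈ grade h,
    mul x (mul y z) = (α f g h : k) • mul (mul x y) z
  one_mul : ∀ x, mul one x = x
  mul_one : ∀ x, mul x one = x

namespace ZAlg

variable {G : Type v} [Group G] {k : Type u} [Field k] {α : Cocycle3 G k}

/-- Isomorphisms of algebras in `Z(G, α)`. -/
structure Iso (A : ZAlg.{u, v, w} α) (B : ZAlg.{u, v, w'} α) where
  toEquiv : A.carrier ≃ₗ[k] B.carrier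
  map_grade : ∀ g, ∀ x ∈ A.grade g, toEquiv x ∈ B.grade g
  map_act : ∀ g x, toEquiv (A.act g x) = B.act g (toEquiv x)
  map_mul : ∀ x y, toEquiv (A.mul x y) = B.mul (toEquiv x) (toEquiv y)
  map_one : toEquiv A.one = B.one

variable (A : ZAlg.{u, v, w} α)

/-- Commutativity with respect to the braiding `x ⊗ y ↦ f.y ⊗ x`, `x` of degree `f`. -/
def IsCommutative : Prop :=
  ∀ f, ∀ x ∈ A.grade f, ∀ y, A.mul x y = A.mul (A.act f y) x

/-- The canonical trace function `A → I`, i.e. the trace of the left multiplication. (For `x` of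
degree `f ≠ 1` the left multiplication by `x` moves the degrees, and its trace is zero; for `x` of
degree `1` the associator does not contribute.) -/
noncomputable def trace : A.carrier →ₗ[k] k :=
  LinearMap.trace k A.carrier ∘ₗ A.mul

/-- The pairing `A ⊗ A → I`, `x ⊗ y ↦ trace (x y)`. -/
noncomputable def traceForm : A.carrier →ₗ[k] A.carrier →ₗ[k] k :=
  A.mul.compr₂ A.trace

/-- `A` is separable if its trace pairing is nondegenerate. -/
def IsSeparable : Prop := A.traceForm.Nondegenerate

/-- Two-sided ideals of `A` in `Z(G, α)`: graded, stable under the action, and closed under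
multiplication by elements of `A` from both sides. -/
structure IsIdeal (I : Submodule k A.carrier) : Prop where
  graded : I ≤ ⨆ g, I ⊓ A.grade g
  act_mem : ∀ g, ∀ x ∈ I, A.act g x ∈ I
  mul_mem_left : ∀ y, ∀ x ∈ I, A.mul y x ∈ I
  mul_mem_right : ∀ y, ∀ x ∈ I, A.mul x y ∈ I

/-- `A` is nonzero, and is not the direct sum of two nonzero algebras in `Z(G, α)`. (The summands
of a direct sum of algebras are complementary two-sided ideals, and conversely.) -/
def IsIndecomposable : Prop :=
  Nontrivial A.carrier ∧
    ∀ I J : Submodule k A.carrier, A.IsIdeal I → A.IsIdeal J → IsCompl I J → I = ⊥ ∨ J = ⊥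

/-- Etale algebras: indecomposable, commutative and separable. -/
structure IsEtale : Prop where
  indecomposable : A.IsIndecomposable
  commutative : A.IsCommutative
  separable : A.IsSeparable

end ZAlg

namespace ZObj

variable {G : Type v} [Group G] {k : Type u} [Field k] {α : Cocycle3 G k}

open Classical in
lemma bijective_coe (X : ZObj.{u, v, w} α) :
    Function.Bijective (DirectSum.coeLinearMap X.grade) :=
  (DirectSum.isInternal_submodule_iff_iSupIndep_and_iSup_eq_top _).2 ⟨X.indep, X.iSup_grade⟩

open Classical in
/-- The projection to the component of degree `g`. -/
noncomputable def comp (X : ZObj.{u, v, w} α) (g : G) : X.carrier →ₗ[k] X.carrier :=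
  (X.grade g).subtype ∘ₗ DirectSum.component k G (fun i => X.grade i) g ∘ₗ
    (LinearEquiv.ofBijective (DirectSum.coeLinearMap X.grade) X.bijective_coe).symm.toLinearMap

open Classical in
lemma comp_of_mem (X : ZObj.{u, v, w} α) {g h : G} {x : X.carrier} (hx : x ∈ X.grade h) :
    X.comp g x = if g = h then x else 0 := by
  have : (LinearEquiv.ofBijective (DirectSum.coeLinearMap X.grade) X.bijective_coe).symm x =
      DirectSum.lof k G (fun i => X.grade i) h ⟨x, hx⟩ := by
    rw [LinearEquiv.symm_apply_eq]
    simp [LinearEquiv.ofBijective_apply]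
  simp only [comp, LinearMap.comp_apply, LinearEquiv.coe_coe, this]
  split_ifs with hgh
  · subst hgh
    simp
  · rw [DirectSum.component.of, dif_neg (Ne.symm hgh)]
    simp

lemma act_mem (X : ZObj.{u, v, w} α) (f : G) {g : G} {x : X.carrier} (hx : x ∈ X.grade g) :
    X.act f x ∈ X.grade (f * g * f⁻¹) :=
  X.map_act f g ▸ Submodule.mem_map_of_mem hx

lemma act_one_apply (X : ZObj.{u, v, w} α) (x : X.carrier) : X.act 1 x = x := by
  have hx : x ∈ ⨆ g, X.grade g := X.iSup_grade ▸ Submodule.mem_top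
  induction hx using Submodule.iSup_induction' with
  | mem g x hx =>
    have h := X.act_act 1 1 g x hx
    simp only [Cocycle3.proj, mul_one, one_mul, α.one_left, α.one_mid, inv_one, Units.val_one,
      one_smul, α.one_right] at h
    exact ((X.act_bijective 1).1 h).symm
  | zero => simp
  | add x y _ _ hx hy => rw [map_add, hx, hy]

end ZObj

section Projective

variable {G : Type v} [Group G] {k : Type u} [Field k] (α : Cocycle3 G k)
  {V : Type w} [AddCommGroup V] [Module k V]
  {grade : G → Submodule k V} {act : G → V →ₗ[k] V}

lemma map_eq_of_projective (one : ∀ x, act 1 x = x)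
    (mem : ∀ f g x, x ∈ grade g → act f x ∈ grade (f * g * f⁻¹))
    (mul : ∀ f g h, ∀ x ∈ grade h, act (f * g) x = (α.proj f g h : k) • act f (act g x))
    (f g : G) : (grade g).map (act f) = grade (f * g * f⁻¹) := by
  refine le_antisymm ?_ ?_
  · rintro _ ⟨x, hx, rfl⟩
    exact mem f g x hx
  · intro y hy
    have h1 := mem f⁻¹ _ y hy
    have h2 := mul f f⁻¹ _ y hy
    rw [mul_inv_cancel, one, ← map_smul] at h2
    rw [h2]
    refine Submodule.mem_map_of_mem (Submodule.smul_mem _ _ ?_)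
    convert h1 using 2
    group

lemma bijective_of_projective [FiniteDimensional k V] (top : ⨆ g, grade g = ⊤)
    (one : ∀ x, act 1 x = x)
    (mem : ∀ f g x, x ∈ grade g → act f x ∈ grade (f * g * f⁻¹))
    (mul : ∀ f g h, ∀ x ∈ grade h, act (f * g) x = (α.proj f g h : k) • act f (act g x))
    (f : G) : Function.Bijective (act f) := by
  have hs : Function.Surjective (act f) := by
    rw [← LinearMap.range_eq_top, eq_top_iff, ← top]
    refine iSup_le fun g => ?_
    have h := map_eq_of_projective α one mem mul f (f⁻¹ * g * f)
    have e : f * (f⁻¹ * g * f) * f⁻¹ = g := by group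
    rw [e] at h
    rw [← h]
    exact LinearMap.map_le_range
  exact ⟨LinearMap.injective_iff_surjective.2 hs, hs⟩

end Projective

section TwistedGroupAlgebra

variable {H : Type v} [Group H] {k : Type u} [Field k]

/-- The conditions on the data `F ⊴ H`, `γ ∈ C²(F, kˣ)` (a normalised cochain) and
`ε : H × F → kˣ` that define an etale algebra in `Z(H, β)` with basis `(e_f)`, `f ∈ F`. Here
`MulAut.conjNormal h f` is `h f h⁻¹` as an element of `F`. -/
structure IsCompatible (β : Cocycle3 H k) (F : Subgroup H) [F.Normal] (γ : F → F → kˣ)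
    (ε : H → F → kˣ) : Prop where
  one_left : ∀ f, γ 1 f = 1
  one_right : ∀ f, γ f 1 = 1
  /-- `d γ = β|_F` -/
  coboundary : ∀ f g h : F,
    γ g h * (γ (f * g) h)⁻¹ * γ f (g * h) * (γ f g)⁻¹ = β f g h
  eps1 : ∀ (g h : H) (f : F),
    ε (g * h) f = ε g (MulAut.conjNormal h f) * ε h f * β.proj g h f
  eps2 : ∀ (h : H) (f g : F),
    γ f g * ε h (f * g) = β.tens h f g * ε h f * ε h g *
      γ (MulAut.conjNormal h f) (MulAut.conjNormal h g)
  eps3 : ∀ f g : F,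
    γ f g = ε f g * γ (MulAut.conjNormal (f : H) g) f

variable {β : Cocycle3 H k} {F : Subgroup H} [F.Normal] {γ : F → F → kˣ} {ε : H → F → kˣ}

lemma IsCompatible.eps_one (h : IsCompatible β F γ ε) (x : H) : ε x 1 = 1 := by
  have := h.eps2 x 1 1
  simpa [h.one_left, Cocycle3.tens, β.one_mid, β.one_right, β.one_left] using this

variable (k F) in
/-- The component of degree `h` of the space with basis `(e_f)`, `f ∈ F`. -/
def groupAlgGrade (h : H) : Submodule k (F →₀ k) :=
  Finsupp.supported k k {f : F | (f : H) = h}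

/-- The `H`-action `h(e_f) = ε_h(f) e_{hfh⁻¹}`. -/
noncomputable def groupAlgAct (ε : H → F → kˣ) (h : H) : (F →₀ k) →ₗ[k] (F →₀ k) :=
  Finsupp.linearCombination k fun f => Finsupp.single (MulAut.conjNormal h f) (ε h f : k)

/-- The multiplication `e_f e_g = γ(f, g) e_{fg}`. -/
noncomputable def groupAlgMul (γ : F → F → kˣ) : (F →₀ k) →ₗ[k] (F →₀ k) →ₗ[k] (F →₀ k) :=
  Finsupp.linearCombination k fun f =>
    Finsupp.linearCombination k fun g => Finsupp.single (f * g) (γ f g : k)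

lemma groupAlgAct_single (h : H) (f : F) (c : k) :
    groupAlgAct ε h (Finsupp.single f c) =
      Finsupp.single (MulAut.conjNormal h f) (c * (ε h f : k)) := by
  simp [groupAlgAct]

lemma groupAlgMul_single (f g : F) (c d : k) :
    groupAlgMul γ (Finsupp.single f c) (Finsupp.single g d) =
      Finsupp.single (f * g) (c * d * (γ f g : k)) := by
  simp only [groupAlgMul, Finsupp.linearCombination_single, LinearMap.smul_apply,
    Finsupp.smul_single, smul_eq_mul, _root_.mul_assoc]

lemma mem_groupAlgGrade {h : H} {x : F →₀ k} (hx : x ∈ groupAlgGrade k F h) :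
    x = 0 ∨ ∃ (f : F) (c : k), (f : H) = h ∧ x = Finsupp.single f c := by
  by_cases hh : h ∈ F
  · right
    refine ⟨⟨h, hh⟩, x ⟨h, hh⟩, rfl, ?_⟩
    ext g
    by_cases hg : (⟨h, hh⟩ : F) = g
    · subst hg; simp
    · rw [Finsupp.single_eq_of_ne (Ne.symm hg)]
      by_contra hne
      have : g ∈ {f : F | (f : H) = h} := hx (by simpa using hne)
      exact hg (Subtype.ext (Eq.symm this))
  · left
    ext g
    by_contra hne
    have : g ∈ {f : F | (f : H) = h} := hx (by simpa using hne)
    exact hh (this ▸ g.2)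

lemma single_mem_groupAlgGrade (f : F) (c : k) {h : H} (hf : (f : H) = h) :
    Finsupp.single f c ∈ groupAlgGrade k F h :=
  Finsupp.single_mem_supported k c hf

lemma iSupIndep_groupAlgGrade : iSupIndep (groupAlgGrade k F) := by
  intro h
  rw [Submodule.disjoint_def]
  intro x hx hx'
  have h1 : (⨆ j, ⨆ (_ : j ≠ h), groupAlgGrade k F j) ≤
      Finsupp.supported k k {f : F | (f : H) ≠ h} := by
    refine iSup₂_le fun j hj => Finsupp.supported_mono ?_
    rintro f rfl
    exact hj
  have h2 := h1 hx'
  ext f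
  by_contra hne
  have hf : f ∈ x.support := by simpa using hne
  exact h2 hf (hx hf)

lemma iSup_groupAlgGrade : ⨆ h, groupAlgGrade k F h = ⊤ := by
  rw [eq_top_iff]
  rintro x -
  induction x using Finsupp.induction_linear with
  | zero => exact zero_mem _
  | add x y hx hy => exact add_mem hx hy
  | single f c => exact Submodule.mem_iSup_of_mem (f : H) (single_mem_groupAlgGrade f c rfl)

lemma groupAlgAct_mem (f : H) {g : H} {x : F →₀ k} (hx : x ∈ groupAlgGrade k F g) :
    groupAlgAct ε f x ∈ groupAlgGrade k F (f * g * f⁻¹) := by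
  obtain rfl | ⟨a, c, rfl, rfl⟩ := mem_groupAlgGrade hx
  · simp
  · rw [groupAlgAct_single]
    exact single_mem_groupAlgGrade _ _ (by simp)

lemma IsCompatible.act_act (h : IsCompatible β F γ ε) {f g l : H} {x : F →₀ k}
    (hx : x ∈ groupAlgGrade k F l) :
    groupAlgAct ε (f * g) x = (β.proj f g l : k) • groupAlgAct ε f (groupAlgAct ε g x) := by
  obtain rfl | ⟨a, c, rfl, rfl⟩ := mem_groupAlgGrade hx
  · simp
  · simp only [groupAlgAct_single, Finsupp.smul_single, smul_eq_mul, h.eps1, map_mul,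
      MulAut.mul_apply, Units.val_mul]
    congr 1
    ring

lemma IsCompatible.act_one_apply (h : IsCompatible β F γ ε) (x : F →₀ k) :
    groupAlgAct ε 1 x = x := by
  have h1 : ∀ f, ε 1 f = 1 := fun f => by
    simpa [Cocycle3.proj, β.one_left, β.one_mid, β.one_right] using h.eps1 1 1 f
  induction x using Finsupp.induction_linear with
  | zero => simp
  | add x y hx hy => rw [map_add, hx, hy]
  | single f c => simp [groupAlgAct_single, h1]

/-- The algebra `k[F, γ, ε]` in `Z(H, β)`. -/
noncomputable def twistedGroupAlg [Finite H] (h : IsCompatible β F γ ε) : ZAlg.{u, v} β where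
  carrier := F →₀ k
  grade := groupAlgGrade k F
  indep := iSupIndep_groupAlgGrade
  iSup_grade := iSup_groupAlgGrade
  act := groupAlgAct ε
  act_bijective := bijective_of_projective β iSup_groupAlgGrade h.act_one_apply
    (fun f _ _ hx => groupAlgAct_mem f hx) (fun _ _ _ _ hx => h.act_act hx)
  map_act := map_eq_of_projective β h.act_one_apply
    (fun f _ _ hx => groupAlgAct_mem f hx) (fun _ _ _ _ hx => h.act_act hx)
  act_act _ _ _ _ hx := h.act_act hx
  mul := groupAlgMul γ
  one := Finsupp.single 1 1
  mul_mem f g x hx y hy := by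
    obtain rfl | ⟨a, c, rfl, rfl⟩ := mem_groupAlgGrade hx
    · simp
    obtain rfl | ⟨b, d, rfl, rfl⟩ := mem_groupAlgGrade hy
    · simp
    rw [groupAlgMul_single]
    exact single_mem_groupAlgGrade _ _ rfl
  act_mul f g l x hx y hy := by
    obtain rfl | ⟨a, c, rfl, rfl⟩ := mem_groupAlgGrade hx
    · simp
    obtain rfl | ⟨b, d, rfl, rfl⟩ := mem_groupAlgGrade hy
    · simp
    have := congrArg (Units.val) (h.eps2 f a b)
    simp only [Units.val_mul] at this
    simp only [groupAlgAct_single, groupAlgMul_single, Finsupp.smul_single, smul_eq_mul, map_mul]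
    congr 1
    linear_combination (c * d) * this
  one_mem := single_mem_groupAlgGrade _ _ rfl
  act_one f := by simp [groupAlgAct_single, h.eps_one]
  mul_assoc f g l x hx y hy z hz := by
    obtain rfl | ⟨a, c, rfl, rfl⟩ := mem_groupAlgGrade hx
    · simp
    obtain rfl | ⟨b, d, rfl, rfl⟩ := mem_groupAlgGrade hy
    · simp
    obtain rfl | ⟨e, r, rfl, rfl⟩ := mem_groupAlgGrade hz
    · simp
    have h1 : γ b e * γ a (b * e) = β a b e * γ a b * γ (a * b) e := by
      rw [← h.coboundary]
      apply Additive.ofMul.injective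
      simp only [ofMul_mul, ofMul_inv]
      abel
    have := congrArg (Units.val) h1
    simp only [Units.val_mul] at this
    simp only [groupAlgMul_single, Finsupp.smul_single, smul_eq_mul, mul_assoc]
    congr 1
    linear_combination (c * d * r) * this
  one_mul x := by
    induction x using Finsupp.induction_linear with
    | zero => simp
    | add x y hx hy => rw [map_add, hx, hy]
    | single f c => simp [groupAlgMul_single, h.one_left]
  mul_one x := by
    induction x using Finsupp.induction_linear with
    | zero => simp
    | add x y hx hy => rw [map_add, LinearMap.add_apply, hx, hy]
    | single f c => simp [groupAlgMul_single, h.one_right]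

end TwistedGroupAlgebra

section Transfer

variable {G : Type v} [Group G] {k : Type u} [Field k] {α : Cocycle3 G k} {H : Subgroup G}

/-- The components of an object of `Z(H, α|_H)`, seen as a `G`-graded space supported in `H`. -/
def ZObj.gradeExt (X : ZObj.{u, v, w} (α.restrict H)) (g : G) : Submodule k X.carrier :=
  ⨆ hg : g ∈ H, X.grade ⟨g, hg⟩

/-- The component of degree `f` of `E(X)`: the maps `a : G → X` with `|a(x)| = x⁻¹ f x` and
`a(x h) = α(h⁻¹, x⁻¹ | f) h⁻¹.a(x)` for `x ∈ G`, `h ∈ H`. -/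
def transferHomog (X : ZObj.{u, v, w} (α.restrict H)) (f : G) :
    Submodule k (G → X.carrier) where
  carrier := {a | (∀ x, a x ∈ X.gradeExt (x⁻¹ * f * x)) ∧
    ∀ (x : G) (h : H), a (x * h) = (α.proj (h : G)⁻¹ x⁻¹ f : k) • X.act h⁻¹ (a x)}
  zero_mem' := ⟨fun _ => zero_mem _, fun _ _ => by simp⟩
  add_mem' ha hb := ⟨fun x => add_mem (ha.1 x) (hb.1 x), fun x h => by
    simp [ha.2 x h, hb.2 x h]⟩
  smul_mem' c a ha := ⟨fun x => Submodule.smul_mem _ _ (ha.1 x), fun x h => by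
    simp [ha.2 x h, smul_comm c]⟩

/-- `E(X)`, the sum of its homogeneous components in the space of all maps `G → X`. -/
def transferSpace (X : ZObj.{u, v, w} (α.restrict H)) : Submodule k (G → X.carrier) :=
  ⨆ f, transferHomog X f

lemma ZObj.mem_gradeExt {X : ZObj.{u, v, w} (α.restrict H)} {g : G} {x : X.carrier}
    (hx : x ∈ X.gradeExt g) : x = 0 ∨ ∃ hg : g ∈ H, x ∈ X.grade ⟨g, hg⟩ := by
  by_cases hg : g ∈ H
  · right
    exact ⟨hg, by simpa [gradeExt, hg] using hx⟩
  · left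
    simpa [gradeExt, hg] using hx

lemma ZObj.mem_gradeExt_of_mem {X : ZObj.{u, v, w} (α.restrict H)} {h : H} {g : G}
    {x : X.carrier} (hx : x ∈ X.grade h) (e : (h : G) = g) : x ∈ X.gradeExt g := by
  subst e
  simpa [gradeExt] using hx

variable [Finite G]

attribute [local instance] Fintype.ofFinite

/-- The component of degree `f` of a map `G → X`. -/
noncomputable def mapComp (X : ZObj.{u, v, w} (α.restrict H)) (f : G) :
    (G → X.carrier) →ₗ[k] (G → X.carrier) :=
  open Classical in
  LinearMap.pi fun x => ∑ u : H, (if x⁻¹ * f * x = u then (1 : k) else 0) •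
    (X.comp u ∘ₗ LinearMap.proj x)

/-- The action on maps `G → X`: `(g.a)(x) = α(x⁻¹, g | f)⁻¹ a(g⁻¹ x)` for `a` of degree `f`. It is
extended to all maps by linearity, using that the part of `a(g⁻¹ x)` of degree `u` comes from the
part of `a` of degree `f = g⁻¹ x u x⁻¹ g`. -/
noncomputable def mapAct (X : ZObj.{u, v, w} (α.restrict H)) (g : G) :
    (G → X.carrier) →ₗ[k] (G → X.carrier) :=
  LinearMap.pi fun x => ∑ u : H,
    (((α.proj x⁻¹ g (g⁻¹ * x * u * x⁻¹ * g))⁻¹ : kˣ) : k) •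
      (X.comp u ∘ₗ LinearMap.proj (g⁻¹ * x))

/-- The multiplication on maps `G → B`: `(ab)(x) = α(x⁻¹ | f, g) a(x) b(x)` for `a` of degree `f`
and `b` of degree `g`, extended to all maps by bilinearity. -/
noncomputable def mapMul (B : ZAlg.{u, v, w} (α.restrict H)) :
    (G → B.carrier) →ₗ[k] (G → B.carrier) →ₗ[k] (G → B.carrier) :=
  LinearMap.mk₂ k
    (fun a b x => ∑ u : H, ∑ t : H, (α.tens x⁻¹ (x * u * x⁻¹) (x * t * x⁻¹) : k) •
      B.mul (B.comp u (a x)) (B.comp t (b x)))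
    (fun _ _ _ => by ext; simp [Finset.sum_add_distrib])
    (fun c _ _ => by ext; simp [Finset.smul_sum, smul_comm c])
    (fun _ _ _ => by ext; simp [Finset.sum_add_distrib])
    (fun c _ _ => by ext; simp [Finset.smul_sum, smul_comm c])

lemma sum_smul_comp (X : ZObj.{u, v, w} (α.restrict H)) (c : H → k) (d : k) {g : G}
    {x : X.carrier} (hx : x ∈ X.gradeExt g) (hc : ∀ u : H, (u : G) = g → c u = d) :
    ∑ u : H, c u • X.comp u x = d • x := by
  classical
  obtain rfl | ⟨hg, hx⟩ := ZObj.mem_gradeExt hx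
  · simp
  · rw [Finset.sum_eq_single (⟨g, hg⟩ : H)]
    · rw [hc _ rfl, X.comp_of_mem hx, if_pos rfl]
    · intro u _ hu
      rw [X.comp_of_mem hx, if_neg hu, smul_zero]
    · simp

lemma mapComp_of_mem {X : ZObj.{u, v, w} (α.restrict H)} {f g : G} {a : G → X.carrier}
    (ha : a ∈ transferHomog X g) : mapComp X f a = open Classical in if f = g then a else 0 := by
  classical
  ext x
  have h := sum_smul_comp X (fun u : H => if x⁻¹ * f * x = u then (1 : k) else 0)
    (if f = g then 1 else 0) (ha.1 x) (fun u hu => by simp [hu])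
  simp only [mapComp, LinearMap.pi_apply, LinearMap.sum_apply, LinearMap.smul_apply,
    LinearMap.comp_apply, LinearMap.proj_apply]
  refine Eq.trans (by congr!) (h.trans ?_)
  split_ifs <;> simp

lemma mapAct_of_mem {X : ZObj.{u, v, w} (α.restrict H)} {f : G} {a : G → X.carrier}
    (ha : a ∈ transferHomog X f) (g x : G) :
    mapAct X g a x = (((α.proj x⁻¹ g f)⁻¹ : kˣ) : k) • a (g⁻¹ * x) := by
  have h := sum_smul_comp X
    (fun u : H => (((α.proj x⁻¹ g (g⁻¹ * x * u * x⁻¹ * g))⁻¹ : kˣ) : k))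
    (((α.proj x⁻¹ g f)⁻¹ : kˣ) : k) (ha.1 (g⁻¹ * x)) (fun u hu => by
      rw [hu]
      congr 3
      group)
  simpa [mapAct] using h

lemma mapMul_of_mem {B : ZAlg.{u, v, w} (α.restrict H)} {f g : G} {a b : G → B.carrier}
    (ha : a ∈ transferHomog B.toZObj f) (hb : b ∈ transferHomog B.toZObj g) (x : G) :
    mapMul B a b x = (α.tens x⁻¹ f g : k) • B.mul (a x) (b x) := by
  classical
  simp only [mapMul, LinearMap.mk₂_apply]
  obtain h0 | ⟨hf, hx⟩ := ZObj.mem_gradeExt (ha.1 x)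
  · simp [h0]
  obtain h0 | ⟨hg, hy⟩ := ZObj.mem_gradeExt (hb.1 x)
  · simp [h0]
  rw [Finset.sum_eq_single (⟨_, hf⟩ : H), Finset.sum_eq_single (⟨_, hg⟩ : H)]
  · rw [B.comp_of_mem hx, B.comp_of_mem hy, if_pos rfl, if_pos rfl]
    congr 3
    · group
    · group
  · intro t _ ht
    rw [B.comp_of_mem hy, if_neg ht]
    simp
  · simp
  · intro u _ hu
    rw [B.comp_of_mem hx, if_neg hu]
    simp
  · simp

lemma mapAct_mem {X : ZObj.{u, v, w} (α.restrict H)} {f : G} {a : G → X.carrier}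
    (ha : a ∈ transferHomog X f) (g : G) : mapAct X g a ∈ transferHomog X (g * f * g⁻¹) := by
  constructor
  · intro x
    rw [mapAct_of_mem ha]
    refine Submodule.smul_mem _ _ ?_
    convert ha.1 (g⁻¹ * x) using 2
    group
  · intro x h
    rw [mapAct_of_mem ha, mapAct_of_mem ha, ← mul_assoc, ha.2, map_smul, smul_smul, smul_smul,
      ← Units.val_mul, ← Units.val_mul]
    congr 2
    have := α.proj_proj (h : G)⁻¹ x⁻¹ g f
    simp only [mul_inv_rev, inv_inv]
    rw [inv_mul_eq_iff_eq_mul, ← mul_assoc, eq_mul_inv_iff_mul_eq]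
    exact this

lemma mapMul_mem {B : ZAlg.{u, v, w} (α.restrict H)} {f g : G} {a b : G → B.carrier}
    (ha : a ∈ transferHomog B.toZObj f) (hb : b ∈ transferHomog B.toZObj g) :
    mapMul B a b ∈ transferHomog B.toZObj (f * g) := by
  constructor
  · intro x
    rw [mapMul_of_mem ha hb]
    refine Submodule.smul_mem _ _ ?_
    obtain h0 | ⟨hf, hx⟩ := ZObj.mem_gradeExt (ha.1 x)
    · simp [h0]
    obtain h0 | ⟨hg, hy⟩ := ZObj.mem_gradeExt (hb.1 x)
    · simp [h0]
    exact ZObj.mem_gradeExt_of_mem (B.mul_mem _ _ _ hx _ hy) (by simp [mul_assoc])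
  · intro x h
    rw [mapMul_of_mem ha hb, mapMul_of_mem ha hb, ha.2, hb.2]
    obtain h0 | ⟨hf, hx⟩ := ZObj.mem_gradeExt (ha.1 x)
    · simp [h0]
    obtain h0 | ⟨hg, hy⟩ := ZObj.mem_gradeExt (hb.1 x)
    · simp [h0]
    rw [map_smul, map_smul, map_smul, LinearMap.smul_apply, B.act_mul _ _ _ _ hx _ hy]
    simp only [smul_smul, ← Units.val_mul]
    congr 2
    have := α.tens_proj (h : G)⁻¹ x⁻¹ f g
    simp only [inv_inv] at this
    simp only [mul_inv_rev, Cocycle3.tens_restrict, Subgroup.coe_inv]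
    rw [← mul_assoc, mul_right_comm, this, mul_assoc]

lemma transferSpace_induction {X : ZObj.{u, v, w} (α.restrict H)}
    {p : (G → X.carrier) → Prop} (mem : ∀ f, ∀ a ∈ transferHomog X f, p a) (zero : p 0)
    (add : ∀ a b, p a → p b → p (a + b)) {a : G → X.carrier} (ha : a ∈ transferSpace X) : p a :=
  Submodule.iSup_induction _ (motive := p) ha mem zero add

lemma transferHomog_le (X : ZObj.{u, v, w} (α.restrict H)) (f : G) :
    transferHomog X f ≤ transferSpace X := le_iSup _ f

lemma mapAct_mem_space (X : ZObj.{u, v, w} (α.restrict H)) (g : G) :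
    ∀ a ∈ transferSpace X, mapAct X g a ∈ transferSpace X := fun _ ha =>
  transferSpace_induction (p := fun a => mapAct X g a ∈ transferSpace X)
    (fun f _ ha => transferHomog_le X _ (mapAct_mem ha g)) (by simp)
    (fun a b ha hb => by rw [map_add]; exact add_mem ha hb) ha

lemma mapMul_mem_space (B : ZAlg.{u, v, w} (α.restrict H)) {a b : G → B.carrier}
    (ha : a ∈ transferSpace B.toZObj) (hb : b ∈ transferSpace B.toZObj) :
    mapMul B a b ∈ transferSpace B.toZObj := by
  refine transferSpace_induction (p := fun a => mapMul B a b ∈ transferSpace B.toZObj)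
    (fun f a ha => ?_) (by simp)
    (fun a b ha hb => by rw [map_add, LinearMap.add_apply]; exact add_mem ha hb) ha
  exact transferSpace_induction (p := fun b => mapMul B a b ∈ transferSpace B.toZObj)
    (fun g b hb => transferHomog_le _ _ (mapMul_mem ha hb)) (by simp)
    (fun a b ha hb => by rw [map_add]; exact add_mem ha hb) hb

lemma one_mem_transferHomog (B : ZAlg.{u, v, w} (α.restrict H)) :
    (fun _ : G => B.one) ∈ transferHomog B.toZObj 1 :=
  ⟨fun x => ZObj.mem_gradeExt_of_mem B.one_mem (by simp), fun x h => by
    simp [B.act_one, Cocycle3.proj, α.one_left, α.one_mid, α.one_right]⟩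

lemma iSupIndep_transfer (X : ZObj.{u, v, w} (α.restrict H)) :
    iSupIndep fun f => (transferHomog X f).comap (transferSpace X).subtype := by
  classical
  intro f
  rw [Submodule.disjoint_def]
  intro a ha ha'
  have h1 : (⨆ j, ⨆ (_ : j ≠ f), (transferHomog X j).comap (transferSpace X).subtype) ≤
      LinearMap.ker (mapComp X f ∘ₗ (transferSpace X).subtype) := by
    refine iSup₂_le fun j hj b hb => ?_
    rw [LinearMap.mem_ker, LinearMap.comp_apply, mapComp_of_mem hb, if_neg hj.symm]
  have h2 := h1 ha'
  rw [LinearMap.mem_ker, LinearMap.comp_apply, mapComp_of_mem ha, if_pos rfl] at h2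
  exact Subtype.ext h2

lemma iSup_transfer (X : ZObj.{u, v, w} (α.restrict H)) :
    ⨆ f, (transferHomog X f).comap (transferSpace X).subtype = ⊤ := by
  apply Submodule.map_injective_of_injective (transferSpace X).injective_subtype
  simp only [Submodule.map_iSup, Submodule.map_comap_subtype, Submodule.map_top,
    Submodule.range_subtype]
  refine le_antisymm (iSup_le fun f => inf_le_left) ?_
  exact iSup_mono fun f => le_inf (transferHomog_le X f) le_rfl

lemma mapAct_one (X : ZObj.{u, v, w} (α.restrict H)) {a : G → X.carrier}
    (ha : a ∈ transferSpace X) : mapAct X 1 a = a :=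
  transferSpace_induction (p := fun a => mapAct X 1 a = a)
    (fun f a ha => by
      ext x
      rw [mapAct_of_mem ha]
      simp [Cocycle3.proj, α.one_mid, α.one_right])
    (by simp) (fun a b ha hb => by rw [map_add, ha, hb]) ha

lemma mapAct_mul {X : ZObj.{u, v, w} (α.restrict H)} {f : G} {a : G → X.carrier}
    (ha : a ∈ transferHomog X f) (g h : G) :
    mapAct X (g * h) a = (α.proj g h f : k) • mapAct X g (mapAct X h a) := by
  ext x
  rw [Pi.smul_apply, mapAct_of_mem ha, mapAct_of_mem (mapAct_mem ha h), mapAct_of_mem ha,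
    smul_smul, smul_smul, ← Units.val_mul, ← Units.val_mul]
  have := α.proj_proj x⁻¹ g h f
  congr 2
  · simp only [mul_inv_rev, inv_inv]
    rw [inv_eq_iff_eq_inv, eq_inv_iff_mul_eq_one, ← mul_assoc, ← mul_assoc, this]
    apply Additive.ofMul.injective
    simp only [ofMul_mul, ofMul_inv, ofMul_one]
    abel
  · simp [mul_assoc]

/-- The transfer `E(X)` of an object `X` of `Z(H, α|_H)`, an object of `Z(G, α)`. -/
noncomputable def transferObj (X : ZObj.{u, v, w} (α.restrict H)) : ZObj.{u, v, max v w} α where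
  carrier := transferSpace X
  grade f := (transferHomog X f).comap (transferSpace X).subtype
  indep := iSupIndep_transfer X
  iSup_grade := iSup_transfer X
  act g := (mapAct X g).restrict (mapAct_mem_space X g)
  act_bijective := bijective_of_projective α (iSup_transfer X)
    (fun a => Subtype.ext (mapAct_one X a.2)) (fun g _ _ ha => mapAct_mem ha g)
    (fun g h _ _ ha => Subtype.ext (mapAct_mul ha g h))
  map_act := map_eq_of_projective α
    (fun a => Subtype.ext (mapAct_one X a.2)) (fun g _ _ ha => mapAct_mem ha g)
    (fun g h _ _ ha => Subtype.ext (mapAct_mul ha g h))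
  act_act g h _ _ ha := Subtype.ext (mapAct_mul ha g h)

lemma mapAct_mapMul {B : ZAlg.{u, v, w} (α.restrict H)} {g h : G} {a b : G → B.carrier}
    (ha : a ∈ transferHomog B.toZObj g) (hb : b ∈ transferHomog B.toZObj h) (f : G) :
    mapAct B.toZObj f (mapMul B a b) =
      (α.tens f g h : k) • mapMul B (mapAct B.toZObj f a) (mapAct B.toZObj f b) := by
  ext x
  rw [Pi.smul_apply, mapAct_of_mem (mapMul_mem ha hb), mapMul_of_mem ha hb,
    mapMul_of_mem (mapAct_mem ha f) (mapAct_mem hb f), mapAct_of_mem ha, mapAct_of_mem hb,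
    map_smul, map_smul, LinearMap.smul_apply]
  simp only [smul_smul, ← Units.val_mul]
  congr 2
  have := α.tens_proj x⁻¹ f g h
  simp only [mul_inv_rev, inv_inv]
  rw [inv_mul_eq_iff_eq_mul]
  simp only [← mul_assoc]
  rw [eq_mul_inv_iff_mul_eq, eq_mul_inv_iff_mul_eq, this]

lemma mapMul_assoc {B : ZAlg.{u, v, w} (α.restrict H)} {f g h : G} {a b c : G → B.carrier}
    (ha : a ∈ transferHomog B.toZObj f) (hb : b ∈ transferHomog B.toZObj g)
    (hc : c ∈ transferHomog B.toZObj h) :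
    mapMul B a (mapMul B b c) = (α f g h : k) • mapMul B (mapMul B a b) c := by
  ext x
  rw [Pi.smul_apply, mapMul_of_mem ha (mapMul_mem hb hc), mapMul_of_mem (mapMul_mem ha hb) hc,
    mapMul_of_mem ha hb, mapMul_of_mem hb hc]
  obtain h0 | ⟨hf, hx⟩ := ZObj.mem_gradeExt (ha.1 x)
  · simp [h0]
  obtain h0 | ⟨hg, hy⟩ := ZObj.mem_gradeExt (hb.1 x)
  · simp [h0]
  obtain h0 | ⟨hh, hz⟩ := ZObj.mem_gradeExt (hc.1 x)
  · simp [h0]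
  rw [map_smul, B.mul_assoc _ _ _ _ hx _ hy _ hz, map_smul, LinearMap.smul_apply]
  simp only [smul_smul, ← Units.val_mul]
  congr 2
  have := α.tens_tens x⁻¹ f g h
  simp only [inv_inv] at this
  rw [← mul_assoc, ← mul_assoc]
  exact this.symm

/-- The multiplication of maps, restricted to `E(B)`. -/
noncomputable def transferMul (B : ZAlg.{u, v, w} (α.restrict H)) :
    transferSpace B.toZObj →ₗ[k] transferSpace B.toZObj →ₗ[k] transferSpace B.toZObj :=
  LinearMap.mk₂ k (fun a b => ⟨mapMul B a b, mapMul_mem_space B a.2 b.2⟩)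
    (fun _ _ _ => Subtype.ext (by simp)) (fun _ _ _ => Subtype.ext (by simp))
    (fun _ _ _ => Subtype.ext (by simp)) (fun _ _ _ => Subtype.ext (by simp))

/-- The transfer `E(B)` of an algebra `B` in `Z(H, α|_H)`, an algebra in `Z(G, α)`. -/
noncomputable def transfer (B : ZAlg.{u, v, w} (α.restrict H)) : ZAlg.{u, v, max v w} α where
  toZObj := transferObj B.toZObj
  mul := transferMul B
  one := ⟨fun _ => B.one, transferHomog_le _ _ (one_mem_transferHomog B)⟩
  mul_mem f g a ha b hb := mapMul_mem ha hb
  act_mul f g h a ha b hb := Subtype.ext (mapAct_mapMul ha hb f)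
  one_mem := one_mem_transferHomog B
  act_one f := by
    refine Subtype.ext (funext fun x => ?_)
    refine (mapAct_of_mem (one_mem_transferHomog B) f x).trans ?_
    simp [Cocycle3.proj, α.one_mid, α.one_right, α.one_left]
  mul_assoc f g h a ha b hb c hc := Subtype.ext (mapMul_assoc ha hb hc)
  one_mul a := by
    refine Subtype.ext ?_
    change mapMul B (fun _ => B.one) a.1 = a.1
    refine transferSpace_induction (p := fun a => mapMul B (fun _ => B.one) a = a)
      (fun f a ha => ?_) (by simp) (fun a b ha hb => by rw [map_add, ha, hb]) a.2
    ext x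
    rw [mapMul_of_mem (one_mem_transferHomog B) ha, B.one_mul]
    simp [Cocycle3.tens, α.one_mid, α.one_left]
  mul_one a := by
    refine Subtype.ext ?_
    change mapMul B a.1 (fun _ => B.one) = a.1
    refine transferSpace_induction (p := fun a => mapMul B a (fun _ => B.one) = a)
      (fun f a ha => ?_) (by simp)
      (fun a b ha hb => by rw [map_add, LinearMap.add_apply, ha, hb]) a.2
    ext x
    rw [mapMul_of_mem ha (one_mem_transferHomog B), B.mul_one]
    simp [Cocycle3.tens, α.one_mid, α.one_right]

/-- The algebra `A(H, F, γ, ε) = E(k[F, γ, ε])` in `Z(G, α)`. -/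
noncomputable def etaleAlg (α : Cocycle3 G k) (H : Subgroup G) (F : Subgroup H) [F.Normal]
    (γ : F → F → kˣ) (ε : H → F → kˣ) (h : IsCompatible (α.restrict H) F γ ε) :
    ZAlg.{u, v, max u v} α :=
  transfer (twistedGroupAlg h)

end Transfer

end TwistedCentre

/-! Since `α` is normalised, no twist appears when an element of degree 1 is involved. Thus the
degree-1 component of an étale algebra `A` is an ordinary commutative algebra, and its elements are
central in `A`. Nondegeneracy of the trace makes it reduced, so over an algebraically closed field
it is a product of copies of `k` (`exists_isPoint`). Fix a primitive idempotent `p` and let `H` be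
its stabiliser. Distinct translates of `p` are orthogonal, and their sum over the orbit is an
invariant idempotent, which indecomposability forces to be 1 (`sum_act`). Hence `A` is the sum of
the ideals `(x.p)A`, one for each coset `xH`, and should be recovered by transfer from `pA`.

Two facts determine `pA`. For `x` of degree `f`, braided commutativity gives `px = xp = (f.p)x`,
which vanishes unless `f` fixes `p`; so `pA` is supported in `H`. By separability every nonzero
homogeneous `x` in `pA` has a homogeneous `y` with `xy = p` (`exists_mul_eq`). So the nonzero
components of `pA` are lines and their degrees form a subgroup `F`, normal in `H`. A homogeneous
basis with `p` in degree 1 yields `γ` and `ε` as structure constants, and the axioms of `A` become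
the required identities (`IsFrame.isCompatible`).

The isomorphism sends `a` to the function `x ↦ p(x⁻¹.a)`. It is injective because the translates of
`p` sum to `|H|` times 1 (`toMap_injective`), and surjective because a function in the transfer can
be reassembled by summing over the group and dividing by `|H|` (`exists_toMap_eq`). -/

namespace TwistedCentre

/-! ### Elements of degree 1 are untwisted -/

namespace Cocycle3

variable {G : Type v} [Group G] {k : Type u} [Field k] (α : Cocycle3 G k)

lemma proj_one_right (f g : G) : α.proj f g 1 = 1 := by
  simp [proj, α.one_left, α.one_mid, α.one_right]

lemma tens_one_mid (f g : G) : α.tens f 1 g = 1 := by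
  simp [tens, α.one_left, α.one_mid]

end Cocycle3

namespace ZObj

variable {G : Type v} [Group G] {k : Type u} [Field k] {α : Cocycle3 G k} (X : ZObj.{u, v, w} α)

lemma homogeneous_induction {p : X.carrier → Prop} (mem : ∀ g, ∀ x ∈ X.grade g, p x) (zero : p 0)
    (add : ∀ x y, p x → p y → p (x + y)) (x : X.carrier) : p x :=
  Submodule.iSup_induction _ (motive := p) (X.iSup_grade ▸ Submodule.mem_top : x ∈ ⨆ g, X.grade g)
    mem zero add

lemma act_mem_one {c : X.carrier} (hc : c ∈ X.grade 1) (f : G) : X.act f c ∈ X.grade 1 := by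
  simpa using X.act_mem f hc

lemma act_mul_of_mem_one {c : X.carrier} (hc : c ∈ X.grade 1) (f g : G) :
    X.act (f * g) c = X.act f (X.act g c) := by
  rw [X.act_act f g 1 c hc, α.proj_one_right, Units.val_one, one_smul]

lemma mem_grade_of_act_mem {f g : G} {x : X.carrier} (hx : X.act f x ∈ X.grade (f * g * f⁻¹)) :
    x ∈ X.grade g := by
  rw [← X.map_act f g] at hx
  obtain ⟨y, hy, hyx⟩ := hx
  exact (X.act_bijective f).1 hyx ▸ hy

end ZObj

namespace ZAlg

variable {G : Type v} [Group G] {k : Type u} [Field k] {α : Cocycle3 G k} (A : ZAlg.{u, v, w} α)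

/-- Normalisation kills the associator as soon as one factor has degree 1, and trilinearity then
removes any homogeneity condition on the other two. -/
lemma mul_assoc_of_left_mem_one {c : A.carrier} (hc : c ∈ A.grade 1) (x y : A.carrier) :
    A.mul c (A.mul x y) = A.mul (A.mul c x) y := by
  induction x using A.homogeneous_induction with
  | zero => simp
  | add x x' hx hx' => simp [hx, hx']
  | mem f x hx =>
    induction y using A.homogeneous_induction with
    | zero => simp
    | add y y' hy hy' => simp [hy, hy']
    | mem g y hy => rw [A.mul_assoc 1 f g c hc x hx y hy, α.one_left, Units.val_one, one_smul]

lemma mul_assoc_of_mid_mem_one {c : A.carrier} (hc : c ∈ A.grade 1) (x y : A.carrier) :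
    A.mul x (A.mul c y) = A.mul (A.mul x c) y := by
  induction x using A.homogeneous_induction with
  | zero => simp
  | add x x' hx hx' => simp [hx, hx']
  | mem f x hx =>
    induction y using A.homogeneous_induction with
    | zero => simp
    | add y y' hy hy' => simp [hy, hy']
    | mem g y hy => rw [A.mul_assoc f 1 g x hx c hc y hy, α.one_mid, Units.val_one, one_smul]

lemma act_mul_of_mem_one {c : A.carrier} (hc : c ∈ A.grade 1) (f : G) (x : A.carrier) :
    A.act f (A.mul c x) = A.mul (A.act f c) (A.act f x) := by
  induction x using A.homogeneous_induction with
  | zero => simp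
  | add x x' hx hx' => simp [hx, hx']
  | mem g x hx => rw [A.act_mul f 1 g c hc x hx, α.tens_one_mid, Units.val_one, one_smul]

lemma mul_mem_of_left_mem_one {c x : A.carrier} {g : G} (hc : c ∈ A.grade 1)
    (hx : x ∈ A.grade g) : A.mul c x ∈ A.grade g := by
  simpa using A.mul_mem 1 g c hc x hx

/-! ### Commutativity, trace and the ring in degree 1 -/

variable {A}

lemma IsCommutative.mul_comm_of_mem_one (h : A.IsCommutative) {c : A.carrier}
    (hc : c ∈ A.grade 1) (x : A.carrier) : A.mul c x = A.mul x c := by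
  rw [h 1 c hc x, A.act_one_apply]

open Classical in
lemma trace_eq_zero_of_mem {g : G} (hg : g ≠ 1) {x : A.carrier} (hx : x ∈ A.grade g) :
    A.trace x = 0 :=
  LinearMap.trace_eq_zero_of_mapsTo_ne (N := A.grade) A.bijective_coe (fun h => g * h)
    (fun h e => hg (by simpa using e)) (fun h y hy => A.mul_mem g h x hx y hy)

/-- The trace vanishes off degree 1, so a homogeneous element of degree `f` can pair nontrivially
only with the component of degree `f⁻¹`. -/
lemma IsSeparable.exists_trace_ne_zero (h : A.IsSeparable) {f : G} {x : A.carrier}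
    (hx : x ∈ A.grade f) (hx0 : x ≠ 0) : ∃ y ∈ A.grade f⁻¹, A.trace (A.mul x y) ≠ 0 := by
  by_contra! hcon
  refine hx0 (h.1 x fun y => ?_)
  change A.trace (A.mul x y) = 0
  induction y using A.homogeneous_induction with
  | zero => simp
  | add y y' hy hy' => simp [hy, hy']
  | mem g y hy =>
    by_cases hg : g = f⁻¹
    · exact hcon y (hg ▸ hy)
    · exact trace_eq_zero_of_mem (fun e => hg (eq_inv_of_mul_eq_one_right e))
        (A.mul_mem f g x hx y hy)

variable (A) in
/-- A primitive idempotent of the component of degree `1`, with residue field `k`. -/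
structure IsPoint (p : A.carrier) : Prop where
  mem : p ∈ A.grade 1
  ne_zero : p ≠ 0
  idem : A.mul p p = p
  exists_smul : ∀ c ∈ A.grade 1, ∃ t : k, A.mul c p = t • p

variable (A) in
/-- The component of degree `1`, an algebra in the usual sense. -/
def Neutral : Type w := A.grade 1

namespace Neutral

instance : AddCommGroup A.Neutral := inferInstanceAs (AddCommGroup (A.grade 1))
instance : Module k A.Neutral := inferInstanceAs (Module k (A.grade 1))
instance : FiniteDimensional k A.Neutral := inferInstanceAs (FiniteDimensional k (A.grade 1))

/-- The component of degree `1` of a commutative algebra is a commutative ring. -/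
@[reducible] def commRing (h : A.IsCommutative) : CommRing A.Neutral where
  __ := (inferInstance : AddCommGroup A.Neutral)
  mul x y := ⟨A.mul x.1 y.1, A.mul_mem_of_left_mem_one x.2 y.2⟩
  one := ⟨A.one, A.one_mem⟩
  left_distrib x y z := Subtype.ext (map_add (A.mul x.1) y.1 z.1)
  right_distrib x y z := Subtype.ext (LinearMap.map_add₂ A.mul x.1 y.1 z.1)
  zero_mul x := Subtype.ext (LinearMap.map_zero₂ A.mul x.1)
  mul_zero x := Subtype.ext (map_zero (A.mul x.1))
  mul_assoc x y z := Subtype.ext (A.mul_assoc_of_left_mem_one x.2 y.1 z.1).symm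
  one_mul x := Subtype.ext (A.one_mul x.1)
  mul_one x := Subtype.ext (A.mul_one x.1)
  mul_comm x y := Subtype.ext (h.mul_comm_of_mem_one x.2 y.1)

/-- The component of degree `1` of a commutative algebra is a `k`-algebra. -/
@[reducible] def algebra (h : A.IsCommutative) :
    letI := commRing h
    Algebra k A.Neutral :=
  letI := commRing h
  Algebra.ofModule (fun r x y => Subtype.ext (LinearMap.map_smul₂ A.mul r x.1 y.1))
    (fun r x y => Subtype.ext (map_smul (A.mul x.1) r y.1))

/-- If `x` is nilpotent, so is `xy` for every `y` of degree 1. Then left multiplication by `xy` on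
all of `A` is nilpotent and has trace zero, against separability. -/
lemma isReduced (h : A.IsCommutative) (hs : A.IsSeparable) :
    letI := commRing h
    IsReduced A.Neutral := by
  let := commRing h
  refine ⟨fun x hx => ?_⟩
  by_contra hx0
  have hx0' : x.1 ≠ 0 := fun e => hx0 (Subtype.ext e)
  obtain ⟨y, hy, hxy⟩ := hs.exists_trace_ne_zero x.2 hx0'
  rw [inv_one] at hy
  let y' : A.Neutral := ⟨y, hy⟩
  have hn : IsNilpotent (x * y') := (Commute.all _ _).isNilpotent_mul_right hx
  obtain ⟨n, hn⟩ := hn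
  -- Degree-1 elements act associatively on the whole of `A`, so nilpotency in the small ring passes
  -- to the endomorphism whose trace is taken.
  have hpow : ∀ (m : ℕ) (z : A.Neutral), (A.mul z.1 : Module.End k A.carrier) ^ m =
      A.mul (z ^ m).1 := by
    intro m z
    induction m with
    | zero =>
      rw [pow_zero, pow_zero]
      exact LinearMap.ext fun a => (A.one_mul a).symm
    | succ m ih =>
      rw [pow_succ, pow_succ, ih]
      exact LinearMap.ext fun a => A.mul_assoc_of_left_mem_one (z ^ m).2 z.1 a
  have hnil : IsNilpotent (A.mul (x * y').1 : Module.End k A.carrier) :=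
    ⟨n, by rw [hpow, hn]; exact map_zero A.mul⟩
  exact hxy (LinearMap.isNilpotent_trace_of_isNilpotent hnil).eq_zero

end Neutral

/-- A reduced Artinian commutative ring is the product of its residue fields; the point is the
indicator of one factor. -/
lemma IsEtale.exists_isPoint [IsAlgClosed k] (h : A.IsEtale) : ∃ p, A.IsPoint p := by
  classical
  let := Neutral.commRing h.commutative
  let := Neutral.algebra h.commutative
  have := Neutral.isReduced h.commutative h.separable
  have : IsArtinianRing A.Neutral := IsArtinianRing.of_finite k A.Neutral
  have hne : (1 : A.Neutral) ≠ 0 := by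
    intro e
    have := h.indecomposable.1
    obtain ⟨x, hx⟩ := exists_ne (0 : A.carrier)
    have e' : A.one = 0 := congrArg Subtype.val e
    exact hx (by rw [← A.one_mul x, e', map_zero, LinearMap.zero_apply])
  have : Nontrivial A.Neutral := ⟨1, 0, hne⟩
  obtain ⟨M⟩ : Nonempty (MaximalSpectrum A.Neutral) := inferInstance
  let e := IsArtinianRing.equivPi A.Neutral
  let p : A.Neutral := e.symm (Pi.single M 1)
  have hM : M.asIdeal.IsMaximal := M.isMaximal
  have hp0 : p ≠ 0 := by
    intro hp
    have := (map_eq_zero_iff e.symm e.symm.injective).1 hp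
    have h1 := congrFun this M
    rw [Pi.single_eq_same] at h1
    exact one_ne_zero h1
  refine ⟨p.1, p.2, fun h0 => hp0 (Subtype.ext h0), ?_, fun c hc => ?_⟩
  · have : p * p = p := by
      rw [← map_mul, ← Pi.single_mul, _root_.one_mul]
    exact congrArg Subtype.val this
  · have : IsDomain (A.Neutral ⧸ M.asIdeal) := inferInstance
    -- The residue field is finite over the algebraically closed `k`, hence equal to it; this
    -- supplies the scalar by which `c` acts on `p`.
    have hsurj := (IsAlgClosed.algebraMap_bijective_of_isIntegral (k := k)
      (K := A.Neutral ⧸ M.asIdeal)).2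
    let c' : A.Neutral := ⟨c, hc⟩
    obtain ⟨t, ht⟩ := hsurj (Ideal.Quotient.mk _ c')
    refine ⟨t, ?_⟩
    have key : c' * p = t • p := by
      have h1 : c' * p = e.symm (c' • Pi.single M 1) := by
        rw [map_smul, smul_eq_mul]
      have h2 : t • p = e.symm (algebraMap k A.Neutral t • Pi.single M 1) := by
        rw [map_smul, smul_eq_mul, Algebra.smul_def]
      rw [h1, h2]
      congr 1
      rw [← Pi.single_smul, ← Pi.single_smul]
      congr 1
      rw [Algebra.smul_def, Algebra.smul_def, _root_.mul_one, _root_.mul_one]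
      exact ht.symm
    exact congrArg Subtype.val key

end ZAlg
end TwistedCentre

/-! ### Points, their stabilisers and their orbits -/

namespace TwistedCentre
namespace ZAlg

attribute [local instance] Fintype.ofFinite

variable {G : Type v} [Group G] {k : Type u} [Field k] {α : Cocycle3 G k} {A : ZAlg.{u, v, w} α}

lemma isIdeal_range_mul (h : A.IsCommutative) {c : A.carrier} (hc : c ∈ A.grade 1)
    (hinv : ∀ g, A.act g c = c) : A.IsIdeal (LinearMap.range (A.mul c)) where
  graded := by
    rintro _ ⟨x, rfl⟩
    induction x using A.homogeneous_induction with
    | zero => simp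
    | add x y hx hy => rw [map_add]; exact add_mem hx hy
    | mem g x hx =>
      exact Submodule.mem_iSup_of_mem g ⟨⟨x, rfl⟩, A.mul_mem_of_left_mem_one hc hx⟩
  act_mem g := by
    rintro _ ⟨x, rfl⟩
    exact ⟨A.act g x, by rw [A.act_mul_of_mem_one hc, hinv]⟩
  mul_mem_left y := by
    rintro _ ⟨x, rfl⟩
    refine ⟨A.mul y x, ?_⟩
    rw [A.mul_assoc_of_left_mem_one hc, h.mul_comm_of_mem_one hc, A.mul_assoc_of_mid_mem_one hc]
  mul_mem_right y := by
    rintro _ ⟨x, rfl⟩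
    exact ⟨A.mul x y, A.mul_assoc_of_left_mem_one hc x y⟩

/-- The invariant central idempotents `c` and `1 - c` split `A` into complementary ideals, so
indecomposability kills one of them. -/
lemma IsEtale.eq_one_of_invariant_idempotent (h : A.IsEtale) {c : A.carrier} (hc : c ∈ A.grade 1)
    (hinv : ∀ g, A.act g c = c) (hidem : A.mul c c = c) (hne : c ≠ 0) : c = A.one := by
  have hc' : A.one - c ∈ A.grade 1 := sub_mem A.one_mem hc
  have hsub : ∀ x, A.mul (A.one - c) x = x - A.mul c x := fun x => by
    rw [map_sub, LinearMap.sub_apply, A.one_mul]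
  have hcc : ∀ x, A.mul c (A.mul c x) = A.mul c x := fun x => by
    rw [A.mul_assoc_of_left_mem_one hc, hidem]
  have hcompl : IsCompl (LinearMap.range (A.mul c)) (LinearMap.range (A.mul (A.one - c))) := by
    refine ⟨Submodule.disjoint_def.2 ?_, codisjoint_iff_le_sup.2 fun x _ => ?_⟩
    · rintro _ ⟨x, rfl⟩ ⟨y, hy⟩
      rw [hsub] at hy
      rw [← hcc x, ← hy, map_sub, hcc, sub_self]
    · exact Submodule.mem_sup.2 ⟨_, ⟨x, rfl⟩, _, ⟨x, rfl⟩, by rw [hsub]; abel⟩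
  obtain h0 | h0 := h.indecomposable.2 _ _ (isIdeal_range_mul h.commutative hc hinv)
    (isIdeal_range_mul h.commutative hc' fun g => by rw [map_sub, A.act_one, hinv]) hcompl
  · have : c ∈ LinearMap.range (A.mul c) := ⟨c, hidem⟩
    rw [h0] at this
    exact absurd ((Submodule.mem_bot k).1 this) hne
  · have : A.one - c ∈ LinearMap.range (A.mul (A.one - c)) := ⟨A.one, A.mul_one _⟩
    rw [h0] at this
    exact (sub_eq_zero.1 ((Submodule.mem_bot k).1 this)).symm

namespace IsPoint

variable {p q : A.carrier}

lemma act (hp : A.IsPoint p) (g : G) : A.IsPoint (A.act g p) where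
  mem := A.act_mem_one hp.mem g
  ne_zero h := hp.ne_zero ((A.act_bijective g).1 (h.trans (map_zero _).symm))
  idem := by rw [← A.act_mul_of_mem_one hp.mem, hp.idem]
  exists_smul c hc := by
    have hc' : c ∈ (A.grade 1).map (A.act g) := by rw [A.map_act]; simpa using hc
    obtain ⟨d, hd, rfl⟩ := hc'
    obtain ⟨t, ht⟩ := hp.exists_smul d hd
    exact ⟨t, by rw [← A.act_mul_of_mem_one hd, ht, map_smul]⟩

/-- The product is a scalar multiple of each factor. If it is nonzero, idempotency makes both
scalars 1, so the product equals both `p` and `q`. -/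
lemma mul_eq_zero (h : A.IsCommutative) (hp : A.IsPoint p) (hq : A.IsPoint q) (hpq : p ≠ q) :
    A.mul p q = 0 := by
  obtain ⟨t, ht⟩ := hq.exists_smul p hp.mem
  obtain ⟨s, hs⟩ := hp.exists_smul q hq.mem
  by_contra hne
  have key : ∀ {p q : A.carrier}, A.IsPoint p → A.mul p q ≠ 0 → ∀ t : k,
      A.mul p q = t • q → A.mul p q = q := by
    intro p q hp hne t ht
    have h1 : A.mul p (A.mul p q) = t • A.mul p q := by
      conv_lhs => rw [ht, map_smul]
    rw [A.mul_assoc_of_left_mem_one hp.mem, hp.idem] at h1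
    have h2 : (1 - t) • A.mul p q = 0 := by rw [sub_smul, one_smul, ← h1, sub_self]
    have h3 : t = 1 := (sub_eq_zero.1 ((smul_eq_zero.1 h2).resolve_right hne)).symm
    rw [ht, h3, one_smul]
  have hc := h.mul_comm_of_mem_one hp.mem q
  have h1 := key hp hne t ht
  have h2 := key hq (hc ▸ hne) s hs
  exact hpq (by rw [← h1, hc, h2])

/-- The stabiliser of a point. -/
def stab (hp : A.IsPoint p) : Subgroup G where
  carrier := {g | A.act g p = p}
  mul_mem' {f g} hf hg := by
    rw [Set.mem_ofPred_eq] at *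
    rw [A.toZObj.act_mul_of_mem_one hp.mem, hg, hf]
  one_mem' := A.act_one_apply p
  inv_mem' {g} hg := by
    rw [Set.mem_ofPred_eq] at *
    conv_lhs => rw [← hg]
    rw [← A.toZObj.act_mul_of_mem_one hp.mem, inv_mul_cancel, A.act_one_apply]

lemma mem_stab {hp : A.IsPoint p} {g : G} : g ∈ hp.stab ↔ A.act g p = p := Iff.rfl

/-- Braided commutativity gives `px = xp = (f.p)x`. Multiplying by `p` once more gives `p(f.p)x`,
which is zero if `f.p` and `p` are distinct points. -/
lemma mem_stab_of_mul_ne_zero (h : A.IsCommutative) (hp : A.IsPoint p) {f : G} {x : A.carrier}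
    (hx : x ∈ A.grade f) (hne : A.mul p x ≠ 0) : f ∈ hp.stab := by
  by_contra hf
  have h1 : A.mul p x = A.mul (A.act f p) x := by
    rw [h.mul_comm_of_mem_one hp.mem, h f x hx]
  have h2 : A.mul p (A.mul p x) = A.mul p x := by
    rw [A.mul_assoc_of_left_mem_one hp.mem, hp.idem]
  rw [h1, A.mul_assoc_of_left_mem_one hp.mem, hp.mul_eq_zero h (hp.act f) (Ne.symm hf), map_zero,
    LinearMap.zero_apply, ← h1] at h2
  exact hne h2.symm

end IsPoint

open Classical in
lemma _root_.Subgroup.sum_ite_mem [Finite G] {M : Type*} [AddCommMonoid M] (H : Subgroup G)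
    (a : M) : ∑ g : G, (if g ∈ H then a else 0) = Nat.card H • a := by
  rw [Finset.sum_ite, Finset.sum_const, Finset.sum_const_zero, add_zero, Nat.card_eq_fintype_card,
    Fintype.card_subtype]

namespace IsPoint

variable {p : A.carrier}

/-- Summing over `G` counts each point of the orbit once for each element of the stabiliser. After
division by that order, the sum is a nonzero invariant idempotent. -/
lemma sum_act [Finite G] [CharZero k] (h : A.IsEtale) (hp : A.IsPoint p) :
    ∑ g : G, A.act g p = (Nat.card hp.stab : k) • A.one := by
  classical
  set e := ∑ g : G, A.act g p with he
  have hn : (Nat.card hp.stab : k) ≠ 0 := Nat.cast_ne_zero.2 Nat.card_pos.ne'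
  have hmem : e ∈ A.grade 1 := sum_mem fun g _ => A.act_mem_one hp.mem g
  have hinv : ∀ g, A.act g e = e := fun g => by
    rw [he, map_sum, ← Equiv.sum_comp (Equiv.mulLeft g) fun x => A.act x p]
    exact Finset.sum_congr rfl fun x _ => (A.toZObj.act_mul_of_mem_one hp.mem g x).symm
  -- By orthogonality only the translates equal to `x.p` survive; after reindexing by `x * y` these
  -- are the terms with `y` in the stabiliser.
  have hmul : ∀ x, A.mul e (A.act x p) = (Nat.card hp.stab : k) • A.act x p := fun x => by
    rw [he, ← Equiv.sum_comp (Equiv.mulLeft x), map_sum, LinearMap.sum_apply,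
      Nat.cast_smul_eq_nsmul, ← Subgroup.sum_ite_mem]
    refine Finset.sum_congr rfl fun y _ => ?_
    rw [Equiv.coe_mulLeft, A.toZObj.act_mul_of_mem_one hp.mem]
    split_ifs with hy
    · rw [mem_stab.1 hy, (hp.act x).idem]
    · exact ((hp.act y).act x).mul_eq_zero h.commutative (hp.act x)
        fun e => hy ((A.act_bijective x).1 e)
  have hee : A.mul e e = (Nat.card hp.stab : k) • e := by
    conv_lhs => rw [he, map_sum, ← he]
    rw [he, Finset.smul_sum]
    exact Finset.sum_congr rfl fun x _ => hmul x
  have hne : e ≠ 0 := fun h0 => by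
    have := hmul 1
    rw [h0, map_zero, LinearMap.zero_apply] at this
    exact smul_ne_zero hn (hp.act 1).ne_zero this.symm
  have h1 := h.eq_one_of_invariant_idempotent (c := (Nat.card hp.stab : k)⁻¹ • e)
    (Submodule.smul_mem _ _ hmem) (fun g => by rw [map_smul, hinv])
    (by rw [map_smul, map_smul, LinearMap.smul_apply, hee, smul_smul _ _ e, inv_mul_cancel₀ hn,
      one_smul]) (smul_ne_zero (inv_ne_zero hn) hne)
  rw [← h1, smul_smul, mul_inv_cancel₀ hn, one_smul]

/-! ### The ideal `pA`: invertibility of homogeneous elements and one-dimensional components -/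

/-- Separability gives `y` with `xy` of nonzero trace. This product has degree 1 and is fixed by
`p`, so it is a scalar multiple of `p`, and the trace shows the scalar to be nonzero. -/
lemma exists_mul_eq (h : A.IsEtale) (hp : A.IsPoint p) {f : G} {x : A.carrier}
    (hx : x ∈ A.grade f) (hpx : A.mul p x = x) (hx0 : x ≠ 0) :
    ∃ y ∈ A.grade f⁻¹, A.mul x y = p := by
  obtain ⟨y, hy, hxy⟩ := h.separable.exists_trace_ne_zero hx hx0
  have hc : A.mul x y ∈ A.grade 1 := by simpa using A.mul_mem _ _ x hx y hy
  obtain ⟨t, ht⟩ := hp.exists_smul _ hc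
  rw [h.commutative.mul_comm_of_mem_one hc, A.mul_assoc_of_left_mem_one hp.mem, hpx] at ht
  have ht0 : t ≠ 0 := by
    rintro rfl
    rw [ht, zero_smul, map_zero] at hxy
    exact hxy rfl
  exact ⟨t⁻¹ • y, Submodule.smul_mem _ _ hy, by
    rw [map_smul, ht, smul_smul, inv_mul_cancel₀ ht0, one_smul]⟩

/-- Braided commutativity `xy = (f.y)x` turns a right inverse into a left inverse of the same
degree. -/
lemma exists_mul_eq' (h : A.IsEtale) (hp : A.IsPoint p) {f : G} {x : A.carrier}
    (hx : x ∈ A.grade f) (hpx : A.mul p x = x) (hx0 : x ≠ 0) :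
    ∃ y ∈ A.grade f⁻¹, A.mul y x = p := by
  obtain ⟨y, hy, hxy⟩ := hp.exists_mul_eq h hx hpx hx0
  exact ⟨A.act f y, by simpa using A.act_mem f hy, by rw [← h.commutative f x hx, hxy]⟩

/-- A left inverse `y` of `x` recovers `z` from `xz`, up to the invertible associator. -/
lemma mul_ne_zero (h : A.IsEtale) (hp : A.IsPoint p) {f g : G} {x z : A.carrier}
    (hx : x ∈ A.grade f) (hpx : A.mul p x = x) (hx0 : x ≠ 0) (hz : z ∈ A.grade g)
    (hpz : A.mul p z = z) (hz0 : z ≠ 0) : A.mul x z ≠ 0 := by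
  obtain ⟨y, hy, hyx⟩ := hp.exists_mul_eq' h hx hpx hx0
  intro h0
  have := A.mul_assoc _ _ _ y hy x hx z hz
  rw [h0, map_zero, hyx, hpz] at this
  exact smul_ne_zero (Units.ne_zero _) hz0 this.symm

/-- With `xy = p`, the element `z = (xy)z` agrees up to the associator with `x(yz)`. Here `yz` has
degree 1 and so acts on `x = xp` by a scalar. -/
lemma exists_eq_smul (h : A.IsEtale) (hp : A.IsPoint p) {f : G} {x z : A.carrier}
    (hx : x ∈ A.grade f) (hpx : A.mul p x = x) (hx0 : x ≠ 0) (hz : z ∈ A.grade f)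
    (hpz : A.mul p z = z) : ∃ t : k, z = t • x := by
  obtain ⟨y, hy, hxy⟩ := hp.exists_mul_eq h hx hpx hx0
  have hyz : A.mul y z ∈ A.grade 1 := by simpa using A.mul_mem _ _ y hy z hz
  obtain ⟨t, ht⟩ := hp.exists_smul _ hyz
  have hxp : A.mul x p = x := by rw [← h.commutative.mul_comm_of_mem_one hp.mem, hpx]
  have h1 : A.mul x (A.mul y z) = t • x := by
    conv_lhs => rw [← hxp]
    rw [← A.mul_assoc_of_mid_mem_one hp.mem, h.commutative.mul_comm_of_mem_one hp.mem, ht,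
      map_smul, hxp]
  rw [A.mul_assoc _ _ _ x hx y hy z hz, hxy, hpz] at h1
  refine ⟨((α f f⁻¹ f)⁻¹ : kˣ) * t, ?_⟩
  rw [mul_smul, ← h1, smul_smul, Units.inv_mul, one_smul]

/-- The degrees that occur in the ideal generated by a point, a subgroup of its stabiliser. -/
def support (h : A.IsEtale) (hp : A.IsPoint p) : Subgroup hp.stab where
  carrier := {f | ∃ x ∈ A.grade (f : G), A.mul p x = x ∧ x ≠ 0}
  one_mem' := ⟨p, hp.mem, hp.idem, hp.ne_zero⟩
  mul_mem' := by
    rintro f g ⟨x, hx, hpx, hx0⟩ ⟨y, hy, hpy, hy0⟩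
    exact ⟨A.mul x y, A.mul_mem _ _ x hx y hy, by rw [A.mul_assoc_of_left_mem_one hp.mem, hpx],
      hp.mul_ne_zero h hx hpx hx0 hy hpy hy0⟩
  inv_mem' := by
    rintro f ⟨x, hx, hpx, hx0⟩
    obtain ⟨y, hy, hxy⟩ := hp.exists_mul_eq h hx hpx hx0
    -- The inverse `y` need not lie in `pA`, so it is projected there; `x(py) = (px)y = p` shows
    -- that the projection is nonzero.
    refine ⟨A.mul p y, A.mul_mem_of_left_mem_one hp.mem hy,
      by rw [A.mul_assoc_of_left_mem_one hp.mem, hp.idem], fun h0 => hp.ne_zero ?_⟩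
    rw [← hxy, ← hpx, h.commutative.mul_comm_of_mem_one hp.mem, ← A.mul_assoc_of_mid_mem_one hp.mem,
      h0, map_zero]

lemma mul_act (hp : A.IsPoint p) (g : hp.stab) (x : A.carrier) :
    A.mul p (A.act g x) = A.act g (A.mul p x) := by
  rw [A.act_mul_of_mem_one hp.mem, mem_stab.1 g.2]

instance support_normal (h : A.IsEtale) (hp : A.IsPoint p) : (hp.support h).Normal where
  conj_mem := by
    rintro f ⟨x, hx, hpx, hx0⟩ g
    exact ⟨A.act g x, A.act_mem g hx, by rw [mul_act, hpx],
      fun h0 => hx0 ((A.act_bijective g).1 (h0.trans (map_zero _).symm))⟩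

/-! ### Homogeneous bases of `pA` and their structure constants -/

/-- A choice of a basis of the ideal generated by a point, consisting of homogeneous elements. -/
structure IsFrame (h : A.IsEtale) (hp : A.IsPoint p) (e : hp.support h → A.carrier) : Prop where
  mem : ∀ f : hp.support h, e f ∈ A.grade ((f : hp.stab) : G)
  point_mul : ∀ f, A.mul p (e f) = e f
  ne_zero : ∀ f, e f ≠ 0
  -- This choice is what makes the cochain `γ` normalised.
  one : e 1 = p

lemma exists_isFrame (h : A.IsEtale) (hp : A.IsPoint p) : ∃ e, IsFrame h hp e := by
  classical
  have h0 : ∀ f : hp.support h, ∃ x ∈ A.grade ((f : hp.stab) : G), A.mul p x = x ∧ x ≠ 0 :=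
    fun f => f.2
  choose e he hpe he0 using h0
  have key : ∀ f : hp.support h, Function.update e 1 p f ∈ A.grade ((f : hp.stab) : G) ∧
      A.mul p (Function.update e 1 p f) = Function.update e 1 p f ∧
      Function.update e 1 p f ≠ 0 := fun f => by
    by_cases hf : f = 1
    · subst hf
      rw [Function.update_self]
      exact ⟨hp.mem, hp.idem, hp.ne_zero⟩
    · rw [Function.update_of_ne hf]
      exact ⟨he f, hpe f, he0 f⟩
  exact ⟨Function.update e 1 p, fun f => (key f).1, fun f => (key f).2.1, fun f => (key f).2.2,
    Function.update_self ..⟩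

namespace IsFrame

variable {h : A.IsEtale} {hp : A.IsPoint p} {e : hp.support h → A.carrier}

lemma exists_eq_smul (he : IsFrame h hp e) (f : hp.support h) {z : A.carrier}
    (hz : z ∈ A.grade ((f : hp.stab) : G)) (hpz : A.mul p z = z) : ∃ t : k, z = t • e f :=
  hp.exists_eq_smul h (he.mem f) (he.point_mul f) (he.ne_zero f) hz hpz

lemma exists_eq_unit_smul (he : IsFrame h hp e) (f : hp.support h) {z : A.carrier}
    (hz : z ∈ A.grade ((f : hp.stab) : G)) (hpz : A.mul p z = z) (hz0 : z ≠ 0) :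
    ∃ t : kˣ, z = (t : k) • e f := by
  obtain ⟨t, rfl⟩ := he.exists_eq_smul f hz hpz
  exact ⟨Units.mk0 t (left_ne_zero_of_smul hz0), rfl⟩

lemma exists_mul (he : IsFrame h hp e) (f g : hp.support h) :
    ∃ t : kˣ, A.mul (e f) (e g) = (t : k) • e (f * g) :=
  he.exists_eq_unit_smul (f * g) (A.mul_mem _ _ _ (he.mem f) _ (he.mem g))
    (by rw [A.mul_assoc_of_left_mem_one hp.mem, he.point_mul])
    (hp.mul_ne_zero h (he.mem f) (he.point_mul f) (he.ne_zero f) (he.mem g) (he.point_mul g)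
      (he.ne_zero g))

lemma exists_act (he : IsFrame h hp e) (g : hp.stab) (f : hp.support h) :
    ∃ t : kˣ, A.act g (e f) = (t : k) • e (MulAut.conjNormal g f) :=
  he.exists_eq_unit_smul _ (by simpa using A.act_mem g (he.mem f))
    (by rw [mul_act, he.point_mul])
    (fun h0 => he.ne_zero f ((A.act_bijective g).1 (h0.trans (map_zero _).symm)))

lemma unit_ext (he : IsFrame h hp e) {f : hp.support h} {s t : kˣ}
    (hst : (s : k) • e f = (t : k) • e f) : s = t :=
  Units.ext (smul_left_injective k (he.ne_zero f) hst)

lemma linearIndependent (he : IsFrame h hp e) : LinearIndependent k e :=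
  (A.indep.comp (f := fun f : hp.support h => ((f : hp.stab) : G))
    (Subtype.val_injective.comp Subtype.val_injective)).linearIndependent _ he.mem he.ne_zero

variable {γ : hp.support h → hp.support h → kˣ} {ε : hp.stab → hp.support h → kˣ}

/-- Each identity is an axiom of `A` read off on basis vectors: `coboundary` is associativity,
`eps1` the projective action, `eps2` compatibility of action and product, `eps3` commutativity, and
normalisation comes from `p` being the unit of `pA`. -/
lemma isCompatible (he : IsFrame h hp e)
    (hγ : ∀ f g, A.mul (e f) (e g) = (γ f g : k) • e (f * g))
    (hε : ∀ (g : hp.stab) (f : hp.support h),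
      A.act g (e f) = (ε g f : k) • e (MulAut.conjNormal g f)) :
    IsCompatible (α.restrict hp.stab) (hp.support h) γ ε where
  one_left f := by
    refine he.unit_ext (f := 1 * f) ?_
    rw [← hγ, he.one, he.point_mul, _root_.one_mul, Units.val_one, one_smul]
  one_right f := by
    refine he.unit_ext (f := f * 1) ?_
    rw [← hγ, he.one, ← h.commutative.mul_comm_of_mem_one hp.mem, he.point_mul, _root_.mul_one,
      Units.val_one, one_smul]
  coboundary f g l := by
    have key := A.mul_assoc _ _ _ _ (he.mem f) _ (he.mem g) _ (he.mem l)
    rw [hγ, hγ, map_smul, hγ, map_smul, LinearMap.smul_apply, hγ, smul_smul, smul_smul, smul_smul,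
      ← Units.val_mul, ← Units.val_mul, ← Units.val_mul, ← _root_.mul_assoc] at key
    have key' := he.unit_ext key
    change _ = α _ _ _
    rw [mul_inv_eq_iff_eq_mul, mul_right_comm, mul_inv_eq_iff_eq_mul, key']
  eps1 g l f := by
    refine he.unit_ext (f := MulAut.conjNormal (g * l) f) ?_
    have key := A.act_act g l _ _ (he.mem f)
    rw [hε l f, map_smul, hε, smul_smul, smul_smul] at key
    rw [← hε]
    refine key.trans ?_
    rw [map_mul, MulAut.mul_apply]
    congr 1
    simp only [Units.val_mul, Cocycle3.proj_restrict]
    ring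
  eps2 l f g := by
    refine he.unit_ext (f := MulAut.conjNormal l (f * g)) ?_
    have key := A.act_mul l _ _ _ (he.mem f) _ (he.mem g)
    rw [hγ, map_smul, hε, hε, hε, map_smul, map_smul, LinearMap.smul_apply, hγ, smul_smul,
      smul_smul, smul_smul, smul_smul, ← map_mul] at key
    rw [Units.val_mul, key]
    congr 1
    simp only [Units.val_mul, Cocycle3.tens_restrict]
    ring
  eps3 f g := by
    refine he.unit_ext (f := f * g) ?_
    have key := h.commutative _ _ (he.mem f) (e g)
    rw [hγ, hε, map_smul, LinearMap.smul_apply, hγ, smul_smul, ← Units.val_mul] at key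
    rw [key]
    congr 2
    exact Subtype.ext (by simp)

end IsFrame

end IsPoint
end ZAlg
end TwistedCentre

/-! ### The isomorphism of `A` with the transfer of `pA` -/

namespace TwistedCentre
namespace ZAlg
namespace IsPoint

attribute [local instance] Fintype.ofFinite

variable {G : Type v} [Group G] {k : Type u} [Field k] {α : Cocycle3 G k} {A : ZAlg.{u, v, w} α}
  {p : A.carrier}

namespace IsFrame

variable {h : A.IsEtale} {hp : A.IsPoint p} {e : hp.support h → A.carrier}

lemma point_mul_linearCombination (he : IsFrame h hp e) (x : hp.support h →₀ k) :
    A.mul p (Finsupp.linearCombination k e x) = Finsupp.linearCombination k e x := by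
  induction x using Finsupp.induction_linear with
  | zero => simp
  | add x y hx hy => simp [hx, hy]
  | single f c => simp [he.point_mul]

lemma exists_single (he : IsFrame h hp e) {g : G} {a : A.carrier} (ha : a ∈ A.grade g)
    (hne : A.mul p a ≠ 0) : ∃ (f : hp.support h) (c : k), ((f : hp.stab) : G) = g ∧
      Finsupp.linearCombination k e (Finsupp.single f c) = A.mul p a := by
  have hg := mem_stab_of_mul_ne_zero h.commutative hp ha hne
  have hpa : A.mul p (A.mul p a) = A.mul p a := by
    rw [A.mul_assoc_of_left_mem_one hp.mem, hp.idem]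
  have hm := A.mul_mem_of_left_mem_one hp.mem ha
  let f : hp.support h := ⟨⟨g, hg⟩, A.mul p a, hm, hpa, hne⟩
  obtain ⟨t, ht⟩ := he.exists_eq_smul f hm hpa
  exact ⟨f, t, rfl, by rw [Finsupp.linearCombination_single, ht]⟩

lemma range_linearCombination (he : IsFrame h hp e) (a : A.carrier) :
    A.mul p a ∈ LinearMap.range (Finsupp.linearCombination k e) := by
  induction a using A.homogeneous_induction with
  | zero => simp
  | add x y hx hy => rw [map_add]; exact add_mem hx hy
  | mem g a ha =>
    by_cases h0 : A.mul p a = 0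
    · rw [h0]; exact zero_mem _
    · obtain ⟨f, c, -, hc⟩ := he.exists_single ha h0
      exact ⟨_, hc⟩

/-- The coordinates of `p a` with respect to a frame. -/
noncomputable def coord (he : IsFrame h hp e) : A.carrier →ₗ[k] (hp.support h →₀ k) :=
  (LinearEquiv.ofInjective (Finsupp.linearCombination k e) he.linearIndependent).symm ∘ₗ
    (A.mul p).codRestrict _ he.range_linearCombination

lemma linearCombination_coord (he : IsFrame h hp e) (a : A.carrier) :
    Finsupp.linearCombination k e (he.coord a) = A.mul p a := by
  have := (LinearEquiv.ofInjective (Finsupp.linearCombination k e)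
    he.linearIndependent).apply_symm_apply ((A.mul p).codRestrict _ he.range_linearCombination a)
  exact congrArg Subtype.val this

lemma coord_eq_iff (he : IsFrame h hp e) {a : A.carrier} {x : hp.support h →₀ k} :
    he.coord a = x ↔ Finsupp.linearCombination k e x = A.mul p a := by
  rw [← he.linearCombination_coord, eq_comm]
  exact (he.linearIndependent.eq_iff (a := x) (b := he.coord a)).symm

lemma coord_linearCombination (he : IsFrame h hp e) (x : hp.support h →₀ k) :
    he.coord (Finsupp.linearCombination k e x) = x :=
  he.coord_eq_iff.2 (he.point_mul_linearCombination x).symm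

lemma linearCombination_mem (he : IsFrame h hp e) {g : hp.stab} {x : hp.support h →₀ k}
    (hx : x ∈ groupAlgGrade k (hp.support h) g) :
    Finsupp.linearCombination k e x ∈ A.grade (g : G) := by
  obtain rfl | ⟨f, c, rfl, rfl⟩ := mem_groupAlgGrade hx
  · simp
  · rw [Finsupp.linearCombination_single]
    exact Submodule.smul_mem _ _ (he.mem f)

variable {γ : hp.support h → hp.support h → kˣ} {ε : hp.stab → hp.support h → kˣ}

lemma linearCombination_groupAlgMul
    (hγ : ∀ f g, A.mul (e f) (e g) = (γ f g : k) • e (f * g)) (x y : hp.support h →₀ k) :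
    Finsupp.linearCombination k e (groupAlgMul γ x y) =
      A.mul (Finsupp.linearCombination k e x) (Finsupp.linearCombination k e y) := by
  induction x using Finsupp.induction_linear with
  | zero => simp
  | add x x' hx hx' => simp [hx, hx']
  | single f c =>
    induction y using Finsupp.induction_linear with
    | zero => simp
    | add y y' hy hy' => simp only [map_add, hy, hy']
    | single g d =>
      simp only [groupAlgMul_single, Finsupp.linearCombination_single, map_smul,
        LinearMap.smul_apply, hγ, smul_smul]
      congr 1
      ring

lemma linearCombination_groupAlgAct
    (hε : ∀ (g : hp.stab) (f : hp.support h),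
      A.act g (e f) = (ε g f : k) • e (MulAut.conjNormal g f))
    (g : hp.stab) (x : hp.support h →₀ k) :
    Finsupp.linearCombination k e (groupAlgAct ε g x) =
      A.act g (Finsupp.linearCombination k e x) := by
  induction x using Finsupp.induction_linear with
  | zero => simp
  | add x x' hx hx' => simp only [map_add, hx, hx']
  | single f c =>
    simp only [groupAlgAct_single, Finsupp.linearCombination_single, map_smul, hε, smul_smul]

lemma coord_act (he : IsFrame h hp e)
    (hε : ∀ (g : hp.stab) (f : hp.support h),
      A.act g (e f) = (ε g f : k) • e (MulAut.conjNormal g f))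
    (g : hp.stab) (a : A.carrier) : he.coord (A.act g a) = groupAlgAct ε g (he.coord a) := by
  rw [he.coord_eq_iff, linearCombination_groupAlgAct hε, he.linearCombination_coord, mul_act]

/-- Since `p` is a central idempotent, `(pa)(pb) = p(ab)`. -/
lemma coord_mul (he : IsFrame h hp e)
    (hγ : ∀ f g, A.mul (e f) (e g) = (γ f g : k) • e (f * g)) (a b : A.carrier) :
    he.coord (A.mul a b) = groupAlgMul γ (he.coord a) (he.coord b) := by
  rw [he.coord_eq_iff, linearCombination_groupAlgMul hγ, he.linearCombination_coord,
    he.linearCombination_coord, A.mul_assoc_of_mid_mem_one hp.mem,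
    ← h.commutative.mul_comm_of_mem_one hp.mem, A.mul_assoc_of_left_mem_one hp.mem, hp.idem,
    A.mul_assoc_of_left_mem_one hp.mem]

lemma coord_one (he : IsFrame h hp e) : he.coord A.one = Finsupp.single 1 1 := by
  rw [he.coord_eq_iff, Finsupp.linearCombination_single, one_smul, he.one, A.mul_one]

/-- The map `a ↦ (x ↦ coordinates of p (x⁻¹.a))`. -/
noncomputable def toMap (he : IsFrame h hp e) : A.carrier →ₗ[k] (G → hp.support h →₀ k) :=
  LinearMap.pi fun x => he.coord ∘ₗ A.act x⁻¹

lemma toMap_apply (he : IsFrame h hp e) (a : A.carrier) (x : G) :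
    he.toMap a x = he.coord (A.act x⁻¹ a) := rfl

lemma toMap_one (he : IsFrame h hp e) (x : G) : he.toMap A.one x = Finsupp.single 1 1 := by
  rw [toMap_apply, A.act_one, coord_one]

variable [Finite G]

lemma coord_mem (he : IsFrame h hp e) (hc : IsCompatible (α.restrict hp.stab) (hp.support h) γ ε)
    {g : G} {a : A.carrier} (ha : a ∈ A.grade g) :
    he.coord a ∈ (twistedGroupAlg hc).gradeExt g := by
  by_cases h0 : A.mul p a = 0
  · have : he.coord a = 0 := he.coord_eq_iff.2 (by rw [h0, map_zero])
    rw [this]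
    exact zero_mem _
  · obtain ⟨f, c, hf, hfc⟩ := he.exists_single ha h0
    rw [he.coord_eq_iff.2 hfc]
    exact ZObj.mem_gradeExt_of_mem (X := (twistedGroupAlg hc).toZObj)
      (single_mem_groupAlgGrade f c rfl) hf

/-- The transformation law is the projective action law for `g⁻¹x⁻¹`, combined with the fact that
elements of the stabiliser commute with multiplication by `p`. -/
lemma toMap_mem (he : IsFrame h hp e) (hc : IsCompatible (α.restrict hp.stab) (hp.support h) γ ε)
    (hε : ∀ (g : hp.stab) (f : hp.support h),
      A.act g (e f) = (ε g f : k) • e (MulAut.conjNormal g f))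
    {f : G} {a : A.carrier} (ha : a ∈ A.grade f) :
    he.toMap a ∈ transferHomog (twistedGroupAlg hc).toZObj f := by
  refine ⟨fun x => he.coord_mem hc (by simpa using A.act_mem x⁻¹ ha), fun x g => ?_⟩
  refine Eq.trans ?_ (congrArg _ (he.coord_act hε g⁻¹ (A.act x⁻¹ a)))
  rw [toMap_apply, mul_inv_rev, A.act_act _ _ _ _ ha, map_smul, Subgroup.coe_inv]
  rfl

lemma toMap_mem_space (he : IsFrame h hp e)
    (hc : IsCompatible (α.restrict hp.stab) (hp.support h) γ ε)
    (hε : ∀ (g : hp.stab) (f : hp.support h),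
      A.act g (e f) = (ε g f : k) • e (MulAut.conjNormal g f)) (a : A.carrier) :
    he.toMap a ∈ transferSpace (twistedGroupAlg hc).toZObj := by
  induction a using A.homogeneous_induction with
  | zero => rw [map_zero]; exact zero_mem _
  | add x y hx hy => rw [map_add]; exact add_mem hx hy
  | mem f a ha => exact transferHomog_le _ f (he.toMap_mem hc hε ha)

lemma toMap_act (he : IsFrame h hp e)
    (hc : IsCompatible (α.restrict hp.stab) (hp.support h) γ ε)
    (hε : ∀ (g : hp.stab) (f : hp.support h),
      A.act g (e f) = (ε g f : k) • e (MulAut.conjNormal g f)) (g : G) (a : A.carrier) :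
    he.toMap (A.act g a) = mapAct (twistedGroupAlg hc).toZObj g (he.toMap a) := by
  induction a using A.homogeneous_induction with
  | zero =>
    simp only [map_zero]
    exact (map_zero (mapAct (twistedGroupAlg hc).toZObj g)).symm
  | add x y hx hy =>
    simp only [map_add, hx, hy]
    exact (map_add (mapAct (twistedGroupAlg hc).toZObj g) _ _).symm
  | mem f a ha =>
    funext x
    refine Eq.trans ?_ (mapAct_of_mem (he.toMap_mem hc hε ha) g x).symm
    rw [toMap_apply, toMap_apply, mul_inv_rev, inv_inv, A.act_act _ _ _ _ ha, map_smul]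
    exact (inv_smul_smul (α.proj x⁻¹ g f) _).symm

lemma toMap_mul (he : IsFrame h hp e)
    (hc : IsCompatible (α.restrict hp.stab) (hp.support h) γ ε)
    (hγ : ∀ f g, A.mul (e f) (e g) = (γ f g : k) • e (f * g))
    (hε : ∀ (g : hp.stab) (f : hp.support h),
      A.act g (e f) = (ε g f : k) • e (MulAut.conjNormal g f)) (a b : A.carrier) :
    he.toMap (A.mul a b) = mapMul (twistedGroupAlg hc) (he.toMap a) (he.toMap b) := by
  induction a using A.homogeneous_induction with
  | zero =>
    simp only [map_zero, LinearMap.zero_apply]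
    exact (LinearMap.map_zero₂ (mapMul (twistedGroupAlg hc)) _).symm
  | add x y hx hy =>
    simp only [map_add, LinearMap.add_apply, hx, hy]
    exact (LinearMap.map_add₂ (mapMul (twistedGroupAlg hc)) _ _ _).symm
  | mem f a ha =>
    induction b using A.homogeneous_induction with
    | zero =>
      simp only [map_zero]
      exact (map_zero (mapMul (twistedGroupAlg hc) (he.toMap a))).symm
    | add x y hx hy =>
      simp only [map_add, hx, hy]
      exact (map_add (mapMul (twistedGroupAlg hc) (he.toMap a)) _ _).symm
    | mem g b hb =>
      funext x
      refine Eq.trans ?_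
        (mapMul_of_mem (he.toMap_mem hc hε ha) (he.toMap_mem hc hε hb) x).symm
      rw [toMap_apply, A.act_mul _ _ _ _ ha _ hb, map_smul, he.coord_mul hγ]
      rfl

variable [CharZero k]

/-- If every `p(x⁻¹.a)` vanishes, so does every `(x.p)a`; summing over `x` gives `|H|` times `a`. -/
lemma toMap_injective (he : IsFrame h hp e) : Function.Injective he.toMap := by
  refine (injective_iff_map_eq_zero _).2 fun a ha => ?_
  have h1 : ∀ x, A.mul (A.act x p) a = 0 := fun x => by
    refine (A.act_bijective x⁻¹).1 ?_
    rw [A.act_mul_of_mem_one (A.act_mem_one hp.mem x), ← A.toZObj.act_mul_of_mem_one hp.mem,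
      inv_mul_cancel, A.act_one_apply, ← he.linearCombination_coord, ← he.toMap_apply, ha,
      Pi.zero_apply, map_zero, map_zero]
  have h2 : A.mul (∑ x : G, A.act x p) a = 0 := by
    rw [map_sum, LinearMap.sum_apply]
    exact Finset.sum_eq_zero fun x _ => h1 x
  rw [hp.sum_act h, map_smul, LinearMap.smul_apply, A.one_mul] at h2
  exact (smul_eq_zero.1 h2).resolve_left (Nat.cast_ne_zero.2 Nat.card_pos.ne')

/-- Each value `b x` is moved back into the ideal `(x.p)A`. The result depends only on the coset of
`x`, and averaging over `G` adds up these pieces. -/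
lemma exists_toMap_eq (he : IsFrame h hp e)
    (hc : IsCompatible (α.restrict hp.stab) (hp.support h) γ ε)
    (hε : ∀ (g : hp.stab) (f : hp.support h),
      A.act g (e f) = (ε g f : k) • e (MulAut.conjNormal g f))
    {f : G} {b : G → hp.support h →₀ k}
    (hb : b ∈ transferHomog (twistedGroupAlg hc).toZObj f) : ∃ a, he.toMap a = b := by
  classical
  -- A preimage under `x⁻¹` is used instead of the image under `x`: the two actions are inverse only
  -- up to a scalar.
  have h0 : ∀ x, ∃ a, A.act x⁻¹ a = Finsupp.linearCombination k e (b x) := fun x =>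
    (A.act_bijective x⁻¹).2 _
  choose a ha using h0
  have hmem : ∀ x, a x ∈ A.grade f := fun x => by
    refine A.mem_grade_of_act_mem (f := x⁻¹) ?_
    rw [ha, inv_inv]
    obtain h0 | ⟨hg, hx⟩ := ZObj.mem_gradeExt (hb.1 x)
    · change b x = 0 at h0
      rw [h0, map_zero]
      exact zero_mem _
    · exact he.linearCombination_mem hx
  have hcoset : ∀ (x : G) (g : hp.stab), a (x * g) = a x := fun x g => by
    refine (A.act_bijective (x * g)⁻¹).1 ?_
    have hbx : b (x * g) = (α.proj (g : G)⁻¹ x⁻¹ f : k) • groupAlgAct ε g⁻¹ (b x) := hb.2 x g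
    rw [ha, hbx, map_smul, linearCombination_groupAlgAct hε, mul_inv_rev,
      A.act_act _ _ _ _ (hmem x), ha, Subgroup.coe_inv]
  have hpoint : ∀ x, A.mul (A.act x p) (a x) = a x := fun x => by
    refine (A.act_bijective x⁻¹).1 ?_
    rw [A.act_mul_of_mem_one (A.act_mem_one hp.mem x), ← A.toZObj.act_mul_of_mem_one hp.mem,
      inv_mul_cancel, A.act_one_apply, ha, he.point_mul_linearCombination]
  -- At `y`, the piece `a (y * z)` is seen through `p(z.p)`, which is zero unless `z` fixes `p`; in
  -- that case the piece equals `a y`.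
  have hval : ∀ y z, he.toMap (a (y * z)) y = if z ∈ hp.stab then b y else 0 := fun y z => by
    split_ifs with hz
    · rw [hcoset y ⟨z, hz⟩, toMap_apply, ha, coord_linearCombination]
    · rw [toMap_apply, coord_eq_iff, map_zero, ← hpoint (y * z),
        A.act_mul_of_mem_one (A.act_mem_one hp.mem _), ← A.toZObj.act_mul_of_mem_one hp.mem,
        inv_mul_cancel_left, A.mul_assoc_of_left_mem_one hp.mem,
        hp.mul_eq_zero h.commutative (hp.act z) (Ne.symm hz), map_zero, LinearMap.zero_apply]
  -- Every coset contributes the same element once for each element of the stabiliser, whence the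
  -- factor.
  refine ⟨(Nat.card hp.stab : k)⁻¹ • ∑ x, a x, ?_⟩
  funext y
  rw [map_smul, Pi.smul_apply, map_sum, Finset.sum_apply, ← Equiv.sum_comp (Equiv.mulLeft y)]
  simp only [Equiv.coe_mulLeft, hval]
  rw [Subgroup.sum_ite_mem, ← Nat.cast_smul_eq_nsmul k, smul_smul,
    inv_mul_cancel₀ (Nat.cast_ne_zero.2 Nat.card_pos.ne'), one_smul]

/-- The isomorphism of an etale algebra with the algebra constructed from a frame. -/
noncomputable def iso (he : IsFrame h hp e)
    (hc : IsCompatible (α.restrict hp.stab) (hp.support h) γ ε)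
    (hγ : ∀ f g, A.mul (e f) (e g) = (γ f g : k) • e (f * g))
    (hε : ∀ (g : hp.stab) (f : hp.support h),
      A.act g (e f) = (ε g f : k) • e (MulAut.conjNormal g f)) :
    A.Iso (etaleAlg α hp.stab (hp.support h) γ ε hc) where
  toEquiv := LinearEquiv.ofBijective
    (LinearMap.codRestrict (transferSpace (twistedGroupAlg hc).toZObj) he.toMap
      (he.toMap_mem_space hc hε))
    ⟨fun _ _ hab => he.toMap_injective (congrArg Subtype.val hab), fun b => by
      obtain ⟨a, ha⟩ := transferSpace_induction (X := (twistedGroupAlg hc).toZObj)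
        (p := fun b => ∃ a, he.toMap a = b)
        (fun f b hb => he.exists_toMap_eq hc hε hb) ⟨0, map_zero _⟩
        (by rintro _ _ ⟨a, rfl⟩ ⟨b, rfl⟩; exact ⟨a + b, map_add _ _ _⟩) b.2
      exact ⟨a, Subtype.ext ha⟩⟩
  map_grade _ _ hx := he.toMap_mem hc hε hx
  map_act g x := Subtype.ext (he.toMap_act hc hε g x)
  map_mul x y := Subtype.ext (he.toMap_mul hc hγ hε x y)
  map_one := Subtype.ext (funext he.toMap_one)

end IsFrame

end IsPoint
end ZAlg
end TwistedCentre

theorem mainTheorem2 {k : Type u} [Field k] [IsAlgClosed k] [CharZero k]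
    {G : Type v} [Group G] [Finite G] (α : TwistedCentre.Cocycle3 G k)
    (A : TwistedCentre.ZAlg.{u, v, w} α) (hA : A.IsEtale) :
    ∃ (H : Subgroup G) (F : Subgroup H) (_ : F.Normal) (γ : F → F → kˣ) (ε : H → F → kˣ)
      (h : TwistedCentre.IsCompatible (α.restrict H) F γ ε),
      Nonempty (A.Iso (TwistedCentre.etaleAlg α H F γ ε h)) := by
  obtain ⟨p, hp⟩ := hA.exists_isPoint
  obtain ⟨e, he⟩ := TwistedCentre.ZAlg.IsPoint.exists_isFrame hA hp
  choose γ hγ using he.exists_mul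
  choose ε hε using he.exists_act
  have hc := he.isCompatible hγ hε
  exact ⟨hp.stab, hp.support hA, inferInstance, γ, ε, hc, ⟨he.iso hc hγ hε⟩⟩
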